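/- **Setting.** Let $\Lambda$ be a finite two-dimensional cell complex with a chosen orientation of every edge and every 2-cell (plaquette); the boundary $\partial p$ of each plaquette is an edge loop. $\mathcal P^+_\Lambda$ is the set of positively oriented plaquettes, and $p^{-1}$ is $p$ with the opposite orientation. Let $N\ge 1$, $\beta\in\mathbb R$, and $G=U(N)$ (put $\eta=0$) or $G=SU(N)$ (put $\eta=1$). A gauge field $Q$ assigns $Q_e\in G$ to every positively oriented edge $e$, with $Q_{e^{-1}}=Q_e^{-1}$; it is extended multiplicatively to edge paths. For a loop $\ell$ put $W_\ell=\operatorname{Tr}Q(\ell)\in\mathbb C$ (so $W_\emptyset=N$ for the empty loop), and $W_p=W_{\partial p}$. $\mathbb E$ is the expectation for the lattice Yang–Mills probability measure $$Z^{-1}\exp\Big(\beta N\sum_{p\in\mathcal P^+_\Lambda}\operatorname{Re}\operatorname{Tr}Q(\partial p)\Big)\prod_e dQ_e ,$$ with $dQ_e$ the Haar probability measure on $G$. **Loop operations.** Fix a positively oriented edge $e$. For a loop $\ell$, let $A$ and $B$ be the sets of positions at which $e$, respectively $e^{-1}$, occurs in $\ell$, let $C=A\cup B$, and for $x\in C$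 let $\omega_x=1$ if $x\in A$, $\omega_x=-1$ if $x\in B$. Write $\ell\setminus e_x$ for $\ell$ with its $x$-th edge removed, read cyclically from the edge following it. * Splits ($x\ne y$ in $C$), segments being read cyclically. If $\omega_x\omega_y=1$: $\times^1_{x,y}\ell$ is the part of $\ell$ from just after $x$ up to and including $y$, and $\times^2_{x,y}\ell$ the part from just after $y$ up to and including $x$. If $\omega_x\omega_y=-1$: the same, with both end edges $x$ and $y$ left out. * Mergers ($x$ a position of $e^{\pm1}$ in $\ell$, $y$ one in $\ell'$): $$\ell\oplus_{x,y}\ell'=(\ell\setminus e_x)\,e^{\omega_x}\,(\ell'\setminus e_y)^{\omega_x\omega_y}\,e^{\omega_x},\qquad \ell\ominus_{x,y}\ell'=(\ell\setminus e_x)\,(\ell'\setminus e_y)^{-\omega_x\omega_y}.$$ **Theorem.** Let $\ell_1,\dots,\ell_n$ ($n\ge1$) be loops, and let $e$ be an edge that lies in at least one of them. Let $A_i,B_i,C_i$ be the sets $A,B,C$ for $\ell_i$, $m=|C_1|$, $t_i=|A_i|-|B_i|$, $t=\sum_{i=1}^n t_i$; for an oriented plaquette $p$ let $C_p$ and $t_p$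 be the corresponding set and number for $\partial p$. Let $\mathcal P^+(e)$ be the set of positively oriented plaquettes whose boundary contains $e$ or $e^{-1}$, and $\mathcal P(e)$ the set of plaquettes of either orientation whose boundary contains $e$ or $e^{-1}$ (so $p\in\mathcal P(e)\iff p^{-1}\in\mathcal P(e)$). Then $$\begin{aligned} \Big(mN-\frac{\eta\,t_1t}{N}\Big)\mathbb E[W_{\ell_1}\cdots W_{\ell_n}] ={}&\sum_{\substack{x,y\in C_1\\ \omega_x\omega_y=-1}}\mathbb E\big[W_{\times^1_{x,y}\ell_1}W_{\times^2_{x,y}\ell_1}W_{\ell_2}\cdots W_{\ell_n}\big] -\sum_{\substack{x\neq y\in C_1\\ \omega_x\omega_y=1}}\mathbb E\big[W_{\times^1_{x,y}\ell_1}W_{\times^2_{x,y}\ell_1}W_{\ell_2}\cdots W_{\ell_n}\big]\\ &+\sum_{i=2}^n\sum_{\substack{x\in C_1,\,y\in C_i\\ \omega_x\omega_y=-1}}\mathbb E\Big[W_{\ell_1\ominus_{x,y}\ell_i}\prod_{j\ne1,i}W_{\ell_j}\Big] -\sum_{i=2}^n\sum_{\substack{x\in C_1,\,y\in C_i\\ \omega_x\omega_y=1}}\mathbb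 E\Big[W_{\ell_1\oplus_{x,y}\ell_i}\prod_{j\ne1,i}W_{\ell_j}\Big]\\ &+\frac{\beta N}{2}\sum_{p\in\mathcal P^+(e)}\sum_{x\in C_1,\,y\in C_p}\mathbb E\big[W_{\ell_1\ominus_{x,y}\partial p}W_{\ell_2}\cdots W_{\ell_n}\big] -\frac{\beta N}{2}\sum_{p\in\mathcal P^+(e)}\sum_{x\in C_1,\,y\in C_p}\mathbb E\big[W_{\ell_1\oplus_{x,y}\partial p}W_{\ell_2}\cdots W_{\ell_n}\big]\\ &-\frac{\eta\beta}{2}\sum_{p\in\mathcal P(e)}t_1t_p\,\mathbb E\big[W_{\ell_1}W_{p^{-1}}W_{\ell_2}\cdots W_{\ell_n}\big]. \end{aligned}$$ All sums over pairs $x,y$ run over ordered pairs. -/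

import Mathlib

open MeasureTheory

namespace LatticeYM

/-! Oriented edges and edge words -/

/-- An oriented edge `e^ω`, with `ω = ±1` relative to the chosen orientation of the edge `e`. -/
abbrev OEdge (E : Type*) := E × ℤˣ

/-- A finite sequence of oriented edges, listed in the order in which they are traversed. -/
abbrev Word (E : Type*) := List (OEdge E)

/-- The inverse (reversed) word. -/
def Word.inv {E : Type*} (w : Word E) : Word E :=
  (w.map fun a => (a.1, -a.2)).reverse

/-- `w ^ ω` for a sign `ω`: the word itself or its inverse. -/
def Word.pow {E : Type*} (w : Word E) (ω : ℤˣ) : Word E :=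
  if ω = 1 then w else w.inv

/-! Finite two-dimensional cell complexes -/

/-- Vertices, and edges with a chosen (positive) orientation. -/
structure OneComplex (V E : Type*) where
  src : E → V
  tgt : E → V

namespace OneComplex

variable {V E : Type*}

/-- The starting point of an oriented edge. -/
def start (K : OneComplex V E) (a : OEdge E) : V := if a.2 = 1 then K.src a.1 else K.tgt a.1

/-- The end point of an oriented edge. -/
def finish (K : OneComplex V E) (a : OEdge E) : V := if a.2 = 1 then K.tgt a.1 else K.src a.1

/-- `K.IsPath u w v`: the word `w` is an edge path from `u` to `v`. -/
def IsPath (K : OneComplex V E) : V → Word E → V → Prop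
  | u, [], v => u = v
  | u, a :: w, v => K.start a = u ∧ K.IsPath (K.finish a) w v

/-- A loop is a closed edge path. -/
def IsLoop (K : OneComplex V E) (w : Word E) : Prop := ∃ v, K.IsPath v w v

end OneComplex

/-- A two-dimensional cell complex: every 2-cell (plaquette), with its chosen positive
orientation, has an edge loop as its boundary. -/
structure TwoComplex (V E F : Type*) extends OneComplex V E where
  bdry : F → Word E
  bdry_isLoop : ∀ p, toOneComplex.IsLoop (bdry p)

/-- The boundary loop of the oriented plaquette `p^ω`. -/
def TwoComplex.obdry {V E F : Type*} (K : TwoComplex V E F) (p : F × ℤˣ) : Word E :=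
  (K.bdry p.1).pow p.2

/-! Occurrences of an edge, and operations on loops -/

section Operations

variable {E : Type*}

/-- The orientation `ω_x` of the oriented edge at position `x`. -/
def sgn (w : Word E) (x : Fin w.length) : ℤˣ := w[x].2

/-- `C`: the occurrences of `e` and of `e⁻¹` in `w`. -/
def occ [DecidableEq E] (e : E) (w : Word E) : Finset (Fin w.length) :=
  Finset.univ.filter fun x => w[x].1 = e

/-- `A`: the occurrences of `e` in `w`. -/
def occPos [DecidableEq E] (e : E) (w : Word E) : Finset (Fin w.length) :=
  Finset.univ.filter fun x => w[x].1 = e ∧ sgn w x = 1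

/-- `B`: the occurrences of `e⁻¹` in `w`. -/
def occNeg [DecidableEq E] (e : E) (w : Word E) : Finset (Fin w.length) :=
  Finset.univ.filter fun x => w[x].1 = e ∧ sgn w x = -1

/-- The net winding `|A| - |B|` of `w` along `e`. -/
def winding [DecidableEq E] (e : E) (w : Word E) : ℤ :=
  ((occPos e w).card : ℤ) - ((occNeg e w).card : ℤ)

/-- `w ∖ e_x`: the oriented edge at position `x` is removed, and the rest is read cyclically
starting right after it. -/
def excise (w : Word E) (x : Fin w.length) : Word E :=
  w.drop (x + 1) ++ w.take x

/-- The part of the loop `w` strictly after position `x` and strictly before position `y`,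
read cyclically (for `x ≠ y`). -/
def arc (w : Word E) (x y : Fin w.length) : Word E :=
  if x < y then (w.take y).drop (x + 1) else w.drop (x + 1) ++ w.take y

/-- First loop of the positive split at `x, y` (the second one is `posSplit w y x`):
from right after `x` up to and including `y`. -/
def posSplit (w : Word E) (x y : Fin w.length) : Word E := arc w x y ++ [w[y]]

/-- First loop of the negative split at `x, y` (the second one is `negSplit w y x`):
strictly between `x` and `y`. -/
def negSplit (w : Word E) (x y : Fin w.length) : Word E := arc w x y

/-- Positive merger: `(w₁ ∖ e_x) e^{ω_x} (w₂ ∖ e_y)^{ω_x ω_y} e^{ω_x}`. -/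
def posMerge (w₁ w₂ : Word E) (x : Fin w₁.length) (y : Fin w₂.length) : Word E :=
  excise w₁ x ++ [w₁[x]] ++ Word.pow (excise w₂ y) (sgn w₁ x * sgn w₂ y) ++ [w₁[x]]

/-- Negative merger: `(w₁ ∖ e_x) (w₂ ∖ e_y)^{-ω_x ω_y}`. -/
def negMerge (w₁ w₂ : Word E) (x : Fin w₁.length) (y : Fin w₂.length) : Word E :=
  excise w₁ x ++ Word.pow (excise w₂ y) (-(sgn w₁ x * sgn w₂ y))

end Operations

/-- `𝒫⁺(e)`: the positively oriented plaquettes whose boundary contains `e` or `e⁻¹`. -/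
def posPlaq {V E F : Type*} [DecidableEq E] [Fintype F]
    (K : TwoComplex V E F) (e : E) : Finset F :=
  Finset.univ.filter fun p => (occ e (K.bdry p)).Nonempty

/-- `𝒫(e)`: the plaquettes, with either orientation, whose boundary contains `e` or `e⁻¹`. -/
def plaq {V E F : Type*} [DecidableEq E] [Fintype F]
    (K : TwoComplex V E F) (e : E) : Finset (F × ℤˣ) :=
  Finset.univ.filter fun p => (occ e (K.obdry p)).Nonempty

/-! The structure groups -/

/-- The two choices of structure group. -/
inductive GaugeKind
  | U
  | SU

/-- `η = 0` for `U(N)` and `η = 1` for `SU(N)`. -/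
def GaugeKind.eta : GaugeKind → ℂ
  | .U => 0
  | .SU => 1

/-- `U(N)`, or `SU(N)` as the subgroup of `U(N)` of matrices of determinant one. -/
def gaugeGroup (N : ℕ) : GaugeKind → Subgroup (Matrix.unitaryGroup (Fin N) ℂ)
  | .U => ⊤
  | .SU =>
    { carrier := {g | (g : Matrix (Fin N) (Fin N) ℂ).det = 1}
      mul_mem' := by
        intro a b ha hb
        simp only [Set.mem_ofPred_eq] at ha hb ⊢
        simp [Matrix.det_mul, ha, hb]
      one_mem' := by simp
      inv_mem' := by
        intro a ha
        simp only [Set.mem_ofPred_eq] at ha ⊢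
        rw [Matrix.UnitaryGroup.inv_val, Matrix.star_eq_conjTranspose, Matrix.det_conjTranspose,
          ha, star_one] }

instance unitaryGroup_compactSpace (N : ℕ) : CompactSpace (Matrix.unitaryGroup (Fin N) ℂ) := by
  have hK : IsCompact
      {M : Matrix (Fin N) (Fin N) ℂ | ∀ i, M i ∈ {r : Fin N → ℂ | ∀ j, r j ∈
        Metric.closedBall (0 : ℂ) 1}} :=
    isCompact_pi_infinite fun _ => isCompact_pi_infinite fun _ => isCompact_closedBall 0 1
  have hcl : IsClosed ((Matrix.unitaryGroup (Fin N) ℂ : Set (Matrix (Fin N) (Fin N) ℂ))) :=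
    isClosed_unitary
  refine isCompact_iff_compactSpace.mp (hK.of_isClosed_subset hcl ?_)
  intro M hM i j
  simpa using entry_norm_bound_of_unitary hM i j

theorem isClosed_gaugeGroup (N : ℕ) (k : GaugeKind) :
    IsClosed (gaugeGroup N k : Set (Matrix.unitaryGroup (Fin N) ℂ)) := by
  cases k with
  | U => exact isClosed_univ
  | SU =>
    exact isClosed_eq (Continuous.matrix_det continuous_subtype_val) continuous_const

instance gaugeGroup_compactSpace (N : ℕ) (k : GaugeKind) : CompactSpace (gaugeGroup N k) :=
  isCompact_iff_compactSpace.mp (isClosed_gaugeGroup N k).isCompact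

noncomputable instance gaugeGroup_measurableSpace (N : ℕ) (k : GaugeKind) :
    MeasurableSpace (gaugeGroup N k) := borel _

instance gaugeGroup_borelSpace (N : ℕ) (k : GaugeKind) : BorelSpace (gaugeGroup N k) := ⟨rfl⟩

/-- The Haar probability measure on the structure group. -/
noncomputable def haar (N : ℕ) (k : GaugeKind) : Measure (gaugeGroup N k) :=
  Measure.haarMeasure ⊤

/-! Gauge fields, Wilson loops and the lattice Yang–Mills measure -/

/-- A gauge field, given by its values on the positively oriented edges. -/
abbrev GaugeField (N : ℕ) (k : GaugeKind) (E : Type*) := E → gaugeGroup N k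

/-- The parallel transport `Q(w)`, with `Q(ψ * γ) = Q(ψ) Q(γ)` if `γ` is traversed first. -/
def holonomy {G E : Type*} [Group G] (Q : E → G) : Word E → G
  | [] => 1
  | a :: w => holonomy Q w * Q a.1 ^ (a.2 : ℤ)

/-- The Wilson loop `W_w = Tr Q(w)`. -/
def wilson {N : ℕ} {k : GaugeKind} {E : Type*} (w : Word E) (Q : GaugeField N k E) : ℂ :=
  Matrix.trace (((holonomy Q w : gaugeGroup N k) : Matrix.unitaryGroup (Fin N) ℂ) :
    Matrix (Fin N) (Fin N) ℂ)

/-- The exponent `β N ∑_{p ∈ 𝒫⁺} Re Tr Q(∂p)`. -/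
noncomputable def action {V E F : Type*} [Fintype F] (K : TwoComplex V E F) (N : ℕ)
    (k : GaugeKind) (β : ℝ) (Q : GaugeField N k E) : ℝ :=
  β * N * ∑ p : F, (wilson (K.bdry p) Q).re

/-- The lattice Yang–Mills probability measure: the product Haar measure with density
`Z⁻¹ exp (β N ∑_p Re Tr Q(∂p))`. -/
noncomputable def ymMeasure {V E F : Type*} [Fintype E] [Fintype F] (K : TwoComplex V E F)
    (N : ℕ) (k : GaugeKind) (β : ℝ) : Measure (GaugeField N k E) :=
  (Measure.pi fun _ : E => haar N k).tilted (action K N k β)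

/-- Expectation with respect to the lattice Yang–Mills measure. -/
noncomputable def ymExp {V E F : Type*} [Fintype E] [Fintype F] (K : TwoComplex V E F)
    (N : ℕ) (k : GaugeKind) (β : ℝ) (f : GaugeField N k E → ℂ) : ℂ :=
  ∫ Q, f Q ∂(ymMeasure K N k β)

end LatticeYM

open LatticeYM

namespace LatticeYM

/-! Measure-theoretic preliminaries -/

/-! The equation is integration by parts on the structure group in the variable `Q e`. Haar measure
is invariant under `Q e ↦ γ t * Q e`, so the derivative of any smooth observable along a
one-parameter subgroup integrates to zero (`integral_deriv_eq_zero`). Applied to `f * exp(action)`,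
this gives the Schwinger–Dyson identity `E[D_X f + f D_X S] = 0` for `X` in the Lie algebra. The
gradients are given by formulas that are complex linear in `X`, so the identity extends to the
complexified Lie algebra (`ymExp_grad`): all matrices for `U(N)`, traceless ones for `SU(N)`.

Cut `ℓ₁` open at an occurrence `x` of `e^{±1}`, at the end point of `e`, where `X` is inserted. Take
for `f` the `(a,b)` entry of the resulting holonomy times the other Wilson loops, take `X = E_ab -
δ_ab (η/N) 1`, and sum over `a, b`. Two contractions do the work: `∑ (P E_ab R)_ab = tr P tr R`
turns a derivative of the cut loop itself into a split, and `∑ A_ab tr(E_ab B) = tr(AB)` turns a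
derivative of another loop or of the action into a merger. The position `x` itself gives `ω_x N W`.
The scalar direction multiplies a holonomy by its winding along `e`, which accounts for every `η`
term. Multiplying by `ω_x` and summing over `x` gives the theorem: the constants add up to `m`, and
the signs in front of the `η` terms to `t₁`. -/

instance unitaryGroup_secondCountable (N : ℕ) :
    SecondCountableTopology (Matrix.unitaryGroup (Fin N) ℂ) := by
  have : SecondCountableTopology (Matrix (Fin N) (Fin N) ℂ) :=
    inferInstanceAs (SecondCountableTopology (Fin N → Fin N → ℂ))
  exact TopologicalSpace.Subtype.secondCountableTopology _

/-- Second countability makes the Borel σ-algebra of the finite product of groups agree with the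
product σ-algebra, so that continuous functions of the gauge field are measurable for `Measure.pi`.
-/
instance gaugeGroup_secondCountable (N : ℕ) (k : GaugeKind) :
    SecondCountableTopology (gaugeGroup N k) :=
  TopologicalSpace.Subtype.secondCountableTopology _

instance haar_isMulLeftInvariant (N : ℕ) (k : GaugeKind) : (haar N k).IsMulLeftInvariant := by
  unfold haar; infer_instance

instance haar_isProbabilityMeasure (N : ℕ) (k : GaugeKind) : IsProbabilityMeasure (haar N k) := by
  constructor
  have := Measure.haarMeasure_self (K₀ := (⊤ : TopologicalSpace.PositiveCompacts (gaugeGroup N k)))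
  simpa [haar] using this

/-- The product Haar measure on gauge fields. -/
noncomputable abbrev haarField (N : ℕ) (k : GaugeKind) (E : Type*) [Fintype E] :
    Measure (GaugeField N k E) := Measure.pi fun _ : E => haar N k

/-! One-parameter subgroups of the structure group -/

/-- The Lie algebra of the structure group, as a set of matrices. -/
def lieSet (N : ℕ) (k : GaugeKind) : Set (Matrix (Fin N) (Fin N) ℂ) :=
  {X | X.conjTranspose = -X ∧ (k = .SU → X.trace = 0)}

theorem mul_diagonal_mul_star_apply {N : ℕ} (A B : Matrix (Fin N) (Fin N) ℂ) (d : Fin N → ℂ)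
    (i j : Fin N) :
    (A * Matrix.diagonal d * star B) i j = ∑ l, A i l * d l * star (B j l) := by
  rw [Matrix.mul_apply]
  simp [Matrix.mul_diagonal]

/-- Since `i X` is Hermitian, `X = U diag(-i v) U*` with real `v`, and `γ t = U diag(exp(-i t v))
U*`. In this form the entries are finite sums of scalar exponentials and the determinant is their
product. -/
theorem exists_unitary_oneParam {N : ℕ} (X : Matrix (Fin N) (Fin N) ℂ)
    (hX : X.conjTranspose = -X) :
    ∃ γ : ℝ → Matrix.unitaryGroup (Fin N) ℂ, (∀ s t, γ (s + t) = γ s * γ t) ∧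
      (∀ i j, HasDerivAt (fun t => (γ t : Matrix (Fin N) (Fin N) ℂ) i j) (X i j) 0) ∧
      ∀ t, (γ t : Matrix (Fin N) (Fin N) ℂ).det = Complex.exp (t * X.trace) := by
  have hH : (Complex.I • X).IsHermitian := by
    rw [Matrix.IsHermitian, Matrix.conjTranspose_smul, hX]
    simp
  set U := hH.eigenvectorUnitary
  set v := hH.eigenvalues
  have hdet : (U : Matrix (Fin N) (Fin N) ℂ).det * (star (U : Matrix (Fin N) (Fin N) ℂ)).det = 1 := by
    rw [← Matrix.det_mul, ← Unitary.coe_star, Unitary.coe_mul_star_self, Matrix.det_one]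
  have hspec : X = (U : Matrix (Fin N) (Fin N) ℂ) *
      Matrix.diagonal (fun i => -Complex.I * (v i : ℂ)) * star (U : Matrix (Fin N) (Fin N) ℂ) := by
    have h := hH.spectral_theorem
    rw [Unitary.conjStarAlgAut_apply] at h
    have h2 : X = (-Complex.I) • (Complex.I • X) := by rw [smul_smul]; simp
    rw [h2, h, ← Matrix.smul_mul, ← Matrix.mul_smul, ← Matrix.diagonal_smul]
    rfl
  let D : ℝ → Matrix.unitaryGroup (Fin N) ℂ := fun t =>
    ⟨Matrix.diagonal fun i => Complex.exp (t * (-Complex.I * (v i : ℂ))), by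
      rw [Matrix.mem_unitaryGroup_iff, Matrix.star_eq_conjTranspose, Matrix.diagonal_conjTranspose,
        Matrix.diagonal_mul_diagonal, ← Matrix.diagonal_one]
      congr 1
      funext i
      simp only [Pi.star_apply, RCLike.star_def, ← Complex.exp_conj, ← Complex.exp_add]
      simp⟩
  refine ⟨fun t => U * D t * star U, fun s t => ?_, fun i j => ?_, fun t => ?_⟩
  · have : D (s + t) = D s * D t := by
      apply Subtype.ext
      simp [D, Matrix.diagonal_mul_diagonal, add_mul, Complex.exp_add, mul_comm]
    simp only [this]
    have h1 : star U * U = 1 := by simp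
    calc U * (D s * D t) * star U = U * D s * 1 * D t * star U := by simp only [mul_one, mul_assoc]
      _ = _ := by rw [← h1]; simp only [mul_assoc]
  · have hX' : X i j = ∑ l, (U : Matrix (Fin N) (Fin N) ℂ) i l * (-Complex.I * (v l : ℂ)) *
        star ((U : Matrix (Fin N) (Fin N) ℂ) j l) := by
      conv_lhs => rw [hspec]
      exact mul_diagonal_mul_star_apply _ _ _ _ _
    have hf : (fun t => ((U * D t * star U : Matrix.unitaryGroup (Fin N) ℂ) :
        Matrix (Fin N) (Fin N) ℂ) i j) = fun t : ℝ => ∑ l, (U : Matrix (Fin N) (Fin N) ℂ) i l *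
          Complex.exp (t * (-Complex.I * (v l : ℂ))) *
        star ((U : Matrix (Fin N) (Fin N) ℂ) j l) := by
      funext t
      exact mul_diagonal_mul_star_apply _ _ _ _ _
    rw [hf, hX']
    refine HasDerivAt.fun_sum fun l _ => ?_
    refine HasDerivAt.mul_const (HasDerivAt.const_mul _ ?_) _
    have h1 : HasDerivAt (fun t : ℝ => (t : ℂ) * (-Complex.I * (v l : ℂ)))
        (-Complex.I * (v l : ℂ)) 0 := by
      simpa using (Complex.ofRealCLM.hasDerivAt (x := (0 : ℝ))).mul_const (-Complex.I * (v l : ℂ))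
    simpa using h1.cexp
  · have htr : X.trace = ∑ i, -Complex.I * (v i : ℂ) := by
      conv_lhs => rw [hspec]
      rw [Matrix.trace_mul_comm, ← mul_assoc, Unitary.coe_star_mul_self, one_mul,
        Matrix.trace_diagonal]
    have : ((U * D t * star U : Matrix.unitaryGroup (Fin N) ℂ) : Matrix (Fin N) (Fin N) ℂ).det
        = ((U : Matrix (Fin N) (Fin N) ℂ).det * (star (U : Matrix (Fin N) (Fin N) ℂ)).det)
          * ∏ i, Complex.exp (t * (-Complex.I * (v i : ℂ))) := by
      simp only [Matrix.UnitaryGroup.mul_val, Matrix.det_mul, D, Matrix.det_diagonal,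
        Unitary.coe_star]
      ring
    rw [this, hdet, one_mul, ← Complex.exp_sum, htr, Finset.mul_sum]

theorem exists_oneParam {N : ℕ} {k : GaugeKind} {X : Matrix (Fin N) (Fin N) ℂ}
    (hX : X ∈ lieSet N k) :
    ∃ γ : ℝ → gaugeGroup N k, (∀ s t, γ (s + t) = γ s * γ t) ∧
      ∀ i j, HasDerivAt (fun t => ((γ t : Matrix.unitaryGroup (Fin N) ℂ) :
        Matrix (Fin N) (Fin N) ℂ) i j) (X i j) 0 := by
  obtain ⟨γ, hmul, hder, hdet⟩ := exists_unitary_oneParam X hX.1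
  have hmem : ∀ t, γ t ∈ gaugeGroup N k := by
    intro t
    cases k with
    | U => exact Subgroup.mem_top _
    | SU =>
      change (γ t : Matrix (Fin N) (Fin N) ℂ).det = 1
      -- The determinant along the subgroup is `exp(t tr X)`, which is 1 for traceless `X`.
      rw [hdet, hX.2 rfl]
      simp
  exact ⟨fun t => ⟨γ t, hmem t⟩, fun s t => Subtype.ext (hmul s t), hder⟩

/-! Holonomies as matrices -/

section Holonomy

variable {G E : Type*} [Group G] (Q : E → G)

theorem holonomy_append (w₁ w₂ : Word E) :
    holonomy Q (w₁ ++ w₂) = holonomy Q w₂ * holonomy Q w₁ := by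
  induction w₁ with
  | nil => simp [holonomy]
  | cons a w ih => simp [holonomy, ih, mul_assoc]

theorem Word.inv_cons (a : OEdge E) (w : Word E) :
    Word.inv (a :: w) = w.inv ++ [(a.1, -a.2)] := by
  simp [Word.inv]

theorem Word.inv_inv (w : Word E) : w.inv.inv = w := by
  simp [Word.inv, Function.comp_def]

theorem holonomy_inv (w : Word E) : holonomy Q w.inv = (holonomy Q w)⁻¹ := by
  induction w with
  | nil => simp [holonomy, Word.inv]
  | cons a w ih => simp [Word.inv_cons, holonomy_append, ih, holonomy]

end Holonomy

section Matrices

variable {N : ℕ} {k : GaugeKind} {E : Type*}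

/-- An element of the structure group as a matrix. -/
def toMat (g : gaugeGroup N k) : Matrix (Fin N) (Fin N) ℂ :=
  ((g : Matrix.unitaryGroup (Fin N) ℂ) : Matrix (Fin N) (Fin N) ℂ)

@[simp] theorem toMat_one : toMat (1 : gaugeGroup N k) = 1 := rfl

@[simp] theorem toMat_mul (g h : gaugeGroup N k) : toMat (g * h) = toMat g * toMat h := rfl

theorem toMat_inv (g : gaugeGroup N k) : toMat g⁻¹ = (toMat g).conjTranspose := rfl

theorem toMat_inv_mul (g : gaugeGroup N k) : toMat g⁻¹ * toMat g = 1 := by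
  rw [← toMat_mul, inv_mul_cancel, toMat_one]

theorem toMat_mul_inv (g : gaugeGroup N k) : toMat g * toMat g⁻¹ = 1 := by
  rw [← toMat_mul, mul_inv_cancel, toMat_one]

theorem continuous_toMat : Continuous (toMat : gaugeGroup N k → _) :=
  continuous_subtype_val.comp continuous_subtype_val

/-- The matrix of the parallel transport along a word. -/
def holMat (Q : GaugeField N k E) (w : Word E) : Matrix (Fin N) (Fin N) ℂ := toMat (holonomy Q w)

/-- The matrix of the parallel transport along an oriented edge. -/
def stepMat (Q : GaugeField N k E) (a : OEdge E) : Matrix (Fin N) (Fin N) ℂ :=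
  toMat (Q a.1 ^ (a.2 : ℤ))

variable (Q : GaugeField N k E)

@[simp] theorem holMat_nil : holMat Q [] = 1 := rfl

theorem holMat_cons (a : OEdge E) (w : Word E) :
    holMat Q (a :: w) = holMat Q w * stepMat Q a := rfl

theorem holMat_singleton (a : OEdge E) : holMat Q [a] = stepMat Q a := by simp [holMat_cons]

theorem holMat_append (w₁ w₂ : Word E) : holMat Q (w₁ ++ w₂) = holMat Q w₂ * holMat Q w₁ := by
  simp [holMat, holonomy_append]

theorem wilson_eq_trace (w : Word E) : wilson w Q = (holMat Q w).trace := rfl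

theorem holMat_inv (w : Word E) : holMat Q w.inv = (holMat Q w).conjTranspose := by
  rw [holMat, holonomy_inv, toMat_inv, holMat]

theorem holMat_inv_mul (w : Word E) : holMat Q w.inv * holMat Q w = 1 := by
  simp only [holMat, holonomy_inv, toMat_inv_mul]

theorem holMat_mul_inv (w : Word E) : holMat Q w * holMat Q w.inv = 1 := by
  simp only [holMat, holonomy_inv, toMat_mul_inv]

theorem stepMat_neg_mul (a : OEdge E) : stepMat Q (a.1, -a.2) * stepMat Q a = 1 := by
  simp [stepMat, ← toMat_mul]

theorem stepMat_mul_neg (a : OEdge E) : stepMat Q a * stepMat Q (a.1, -a.2) = 1 := by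
  simp [stepMat, ← toMat_mul]

theorem wilson_inv (w : Word E) : wilson w.inv Q = star (wilson w Q) := by
  rw [wilson_eq_trace, holMat_inv, Matrix.trace_conjTranspose, ← wilson_eq_trace]

theorem continuous_stepMat (a : OEdge E) :
    Continuous fun Q : GaugeField N k E => stepMat Q a :=
  continuous_toMat.comp ((continuous_apply a.1).zpow _)

theorem continuous_holMat (w : Word E) : Continuous fun Q : GaugeField N k E => holMat Q w := by
  induction w with
  | nil => exact continuous_const
  | cons a w ih => exact ih.matrix_mul (continuous_stepMat a)

@[fun_prop]
theorem continuous_wilson (w : Word E) : Continuous fun Q : GaugeField N k E => wilson w Q :=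
  (continuous_holMat w).matrix_trace

end Matrices

/-! Derivatives along left translations of one edge variable -/

section Gradient

variable {N : ℕ} {k : GaugeKind} {E : Type*} [DecidableEq E]

/-- The derivative of `stepMat Q a` when `Q e` moves in the direction `X * Q e`. -/
def gradStep (e : E) (Q : GaugeField N k E) (X : Matrix (Fin N) (Fin N) ℂ) (a : OEdge E) :
    Matrix (Fin N) (Fin N) ℂ :=
  if a.1 = e then (if a.2 = 1 then X * stepMat Q a else -(stepMat Q a * X)) else 0

/-- The derivative of `holMat Q w` when `Q e` moves in the direction `X * Q e`. -/
def gradHol (e : E) (Q : GaugeField N k E) (X : Matrix (Fin N) (Fin N) ℂ) :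
    Word E → Matrix (Fin N) (Fin N) ℂ
  | [] => 0
  | a :: w => gradHol e Q X w * stepMat Q a + holMat Q w * gradStep e Q X a

/-- `D` is the gradient of `F` with respect to left translations of the variable at `e`. -/
structure HasGrad (e : E) (F : GaugeField N k E → ℂ)
    (D : GaugeField N k E → Matrix (Fin N) (Fin N) ℂ → ℂ) : Prop where
  cont : Continuous F
  cont_grad : ∀ X, Continuous fun Q => D Q X
  deriv : ∀ (γ : ℝ → gaugeGroup N k) (X : Matrix (Fin N) (Fin N) ℂ), X.conjTranspose = -X →
    γ 0 = 1 → (∀ i j, HasDerivAt (fun t => toMat (γ t) i j) (X i j) 0) →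
    ∀ Q, HasDerivAt (fun t => F (Pi.mulSingle e (γ t) * Q)) (D Q X) 0

/-- Entrywise version of `HasGrad` for matrix-valued functions. -/
def HasGradMat (e : E) (F : GaugeField N k E → Matrix (Fin N) (Fin N) ℂ)
    (D : GaugeField N k E → Matrix (Fin N) (Fin N) ℂ → Matrix (Fin N) (Fin N) ℂ) : Prop :=
  ∀ i j, HasGrad e (fun Q => F Q i j) fun Q X => D Q X i j

namespace HasGrad

variable {e : E} {F F' : GaugeField N k E → ℂ}
  {D D' : GaugeField N k E → Matrix (Fin N) (Fin N) ℂ → ℂ}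

theorem const (c : ℂ) : HasGrad (N := N) (k := k) e (fun _ => c) fun _ _ => 0 :=
  ⟨continuous_const, fun _ => continuous_const, fun _ _ _ _ _ _ => hasDerivAt_const _ _⟩

theorem mul (h : HasGrad e F D) (h' : HasGrad e F' D') :
    HasGrad e (fun Q => F Q * F' Q) fun Q X => D Q X * F' Q + F Q * D' Q X where
  cont := h.cont.mul h'.cont
  cont_grad X := ((h.cont_grad X).mul h'.cont).add (h.cont.mul (h'.cont_grad X))
  deriv γ X hX h0 hγ Q := by
    simpa [h0] using (h.deriv γ X hX h0 hγ Q).fun_mul (h'.deriv γ X hX h0 hγ Q)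

theorem add (h : HasGrad e F D) (h' : HasGrad e F' D') :
    HasGrad e (fun Q => F Q + F' Q) fun Q X => D Q X + D' Q X where
  cont := h.cont.add h'.cont
  cont_grad X := (h.cont_grad X).add (h'.cont_grad X)
  deriv γ X hX h0 hγ Q := (h.deriv γ X hX h0 hγ Q).add (h'.deriv γ X hX h0 hγ Q)

theorem const_mul (c : ℂ) (h : HasGrad e F D) :
    HasGrad e (fun Q => c * F Q) fun Q X => c * D Q X where
  cont := continuous_const.mul h.cont
  cont_grad X := continuous_const.mul (h.cont_grad X)
  deriv γ X hX h0 hγ Q := (h.deriv γ X hX h0 hγ Q).const_mul c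

theorem sum {ι : Type*} {s : Finset ι} {F : ι → GaugeField N k E → ℂ}
    {D : ι → GaugeField N k E → Matrix (Fin N) (Fin N) ℂ → ℂ}
    (h : ∀ i ∈ s, HasGrad e (F i) (D i)) :
    HasGrad e (fun Q => ∑ i ∈ s, F i Q) fun Q X => ∑ i ∈ s, D i Q X where
  cont := continuous_finsetSum s fun i hi => (h i hi).cont
  cont_grad X := continuous_finsetSum s fun i hi => (h i hi).cont_grad X
  deriv γ X hX h0 hγ Q := HasDerivAt.fun_sum fun i hi => (h i hi).deriv γ X hX h0 hγ Q

theorem prod {ι : Type*} [DecidableEq ι] {s : Finset ι} {F : ι → GaugeField N k E → ℂ}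
    {D : ι → GaugeField N k E → Matrix (Fin N) (Fin N) ℂ → ℂ}
    (h : ∀ i ∈ s, HasGrad e (F i) (D i)) :
    HasGrad e (fun Q => ∏ i ∈ s, F i Q)
      fun Q X => ∑ i ∈ s, D i Q X * ∏ j ∈ s.erase i, F j Q where
  cont := continuous_finsetProd s fun i hi => (h i hi).cont
  cont_grad X := continuous_finsetSum s fun i hi => ((h i hi).cont_grad X).mul <|
    continuous_finsetProd _ fun j hj => (h j (Finset.mem_of_mem_erase hj)).cont
  deriv γ X hX h0 hγ Q := by
    have := HasDerivAt.fun_finsetProd (u := s) (x := (0 : ℝ))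
      (fun i hi => (h i hi).deriv γ X hX h0 hγ Q)
    simpa [h0, mul_comm] using this

theorem cexp (h : HasGrad e F D) :
    HasGrad e (fun Q => Complex.exp (F Q)) fun Q X => Complex.exp (F Q) * D Q X where
  cont := Complex.continuous_exp.comp h.cont
  cont_grad X := (Complex.continuous_exp.comp h.cont).mul (h.cont_grad X)
  deriv γ X hX h0 hγ Q := by simpa [h0] using (h.deriv γ X hX h0 hγ Q).cexp

end HasGrad

section

variable {e : E} {F F' : GaugeField N k E → Matrix (Fin N) (Fin N) ℂ}
  {D D' : GaugeField N k E → Matrix (Fin N) (Fin N) ℂ → Matrix (Fin N) (Fin N) ℂ}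

theorem HasGradMat.mul (h : HasGradMat e F D) (h' : HasGradMat e F' D') :
    HasGradMat e (fun Q => F Q * F' Q) fun Q X => D Q X * F' Q + F Q * D' Q X := by
  intro i j
  simp only [Matrix.add_apply, Matrix.mul_apply, ← Finset.sum_add_distrib]
  exact HasGrad.sum fun l _ => (h i l).mul (h' l j)

theorem HasGradMat.trace (h : HasGradMat e F D) :
    HasGrad e (fun Q => (F Q).trace) fun Q X => (D Q X).trace :=
  HasGrad.sum fun i _ => h i i

end

theorem hasGradMat_stepMat (e : E) (a : OEdge E) :
    HasGradMat (N := N) (k := k) e (fun Q => stepMat Q a) fun Q X => gradStep e Q X a := by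
  intro i j
  refine ⟨(continuous_stepMat a).matrix_elem i j, fun X => ?_, fun γ X hX h0 hγ Q => ?_⟩
  · refine Continuous.matrix_elem (A := fun Q : GaugeField N k E => gradStep e Q X a) ?_ i j
    unfold gradStep
    split_ifs
    · exact continuous_const.matrix_mul (continuous_stepMat a)
    · exact ((continuous_stepMat a).matrix_mul continuous_const).neg
    · exact continuous_const
  · obtain ⟨e', ω⟩ := a
    by_cases he : e' = e
    · subst he
      rcases Int.units_eq_one_or ω with rfl | rfl
      · simp only [stepMat, gradStep, Pi.mul_apply, Pi.mulSingle_eq_same, Units.val_one, zpow_one,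
          toMat_mul, if_true, Matrix.mul_apply]
        exact HasDerivAt.fun_sum fun l _ => (hγ i l).mul_const _
      · have hne : (-1 : ℤˣ) ≠ 1 := by decide
        simp only [stepMat, gradStep, Pi.mul_apply, Pi.mulSingle_eq_same, Units.val_neg,
          Units.val_one, zpow_neg, zpow_one, mul_inv_rev, toMat_mul, if_true, if_neg hne,
          ← Matrix.mul_neg, Matrix.mul_apply]
        refine HasDerivAt.fun_sum fun l _ => HasDerivAt.const_mul _ ?_
        -- The inverse of a unitary matrix is its conjugate transpose, so its derivative is that of
        -- `γ` conjugated and transposed; `X* = -X` produces the minus sign in `gradStep`.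
        have h := (hγ j l).star
        rw [← hX]
        exact h
    · simpa [stepMat, gradStep, he] using hasDerivAt_const _ _

theorem hasGradMat_holMat (e : E) (w : Word E) :
    HasGradMat (N := N) (k := k) e (fun Q => holMat Q w) fun Q X => gradHol e Q X w := by
  induction w with
  | nil => exact fun i j => HasGrad.const _
  | cons a w ih => exact ih.mul (hasGradMat_stepMat e a)

theorem hasGrad_wilson (e : E) (w : Word E) :
    HasGrad (N := N) (k := k) e (fun Q => wilson w Q) fun Q X => (gradHol e Q X w).trace :=
  (hasGradMat_holMat e w).trace

/-! ### Complex linearity of the gradient formulas in the direction -/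

section Linear

variable (e : E) (Q : GaugeField N k E)

theorem gradStep_add (X Y : Matrix (Fin N) (Fin N) ℂ) (a : OEdge E) :
    gradStep e Q (X + Y) a = gradStep e Q X a + gradStep e Q Y a := by
  unfold gradStep
  split_ifs <;> simp [add_mul, mul_add, add_comm]

theorem gradStep_smul (c : ℂ) (X : Matrix (Fin N) (Fin N) ℂ) (a : OEdge E) :
    gradStep e Q (c • X) a = c • gradStep e Q X a := by
  unfold gradStep
  split_ifs <;> simp

theorem gradHol_add (X Y : Matrix (Fin N) (Fin N) ℂ) (w : Word E) :
    gradHol e Q (X + Y) w = gradHol e Q X w + gradHol e Q Y w := by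
  induction w with
  | nil => simp [gradHol]
  | cons a w ih => simp only [gradHol, ih, gradStep_add, add_mul, mul_add]; abel

theorem gradHol_smul (c : ℂ) (X : Matrix (Fin N) (Fin N) ℂ) (w : Word E) :
    gradHol e Q (c • X) w = c • gradHol e Q X w := by
  induction w with
  | nil => simp [gradHol]
  | cons a w ih => simp [gradHol, ih, gradStep_smul]

end Linear

end Gradient

/-! Integration by parts -/

section IntegrationByParts

/-- A left-invariant measure annihilates derivatives along one-parameter subgroups. -/
theorem integral_deriv_eq_zero {G : Type*} [Group G] [TopologicalSpace G] [IsTopologicalGroup G]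
    [CompactSpace G] [MeasurableSpace G] [BorelSpace G] (μ : Measure G) [IsFiniteMeasure μ]
    [μ.IsMulLeftInvariant] {F D : G → ℂ} (hF : Continuous F) (hD : Continuous D) {γ : ℝ → G}
    (hmul : ∀ s t, γ (s + t) = γ s * γ t)
    (hder : ∀ Q, HasDerivAt (fun t => F (γ t * Q)) (D Q) 0) : ∫ Q, D Q ∂μ = 0 := by
  have hint : ∀ f : G → ℂ, Continuous f → Integrable f μ := fun f hf =>
    hf.integrable_of_hasCompactSupport (HasCompactSupport.of_compactSpace f)
  obtain ⟨C, hC⟩ := (isCompact_range hD).isBounded.exists_norm_le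
  -- The group law moves the derivative at 0 to any `t`, with base point `γ t * Q`; compactness then
  -- bounds it uniformly in `t` and `Q`, as differentiation under the integral requires.
  have hdiff : ∀ (Q : G) (t : ℝ), HasDerivAt (fun s => F (γ s * Q)) (D (γ t * Q)) t := by
    intro Q t
    have h1 := hder (γ t * Q)
    rw [← sub_self t] at h1
    refine (h1.comp_sub_const t t).congr_of_eventuallyEq (Filter.Eventually.of_forall fun s => ?_)
    dsimp only
    rw [← mul_assoc, ← hmul, sub_add_cancel]
  have hF' : ∀ t, Integrable (fun Q => F (γ t * Q)) μ :=
    fun t => hint _ (hF.comp (continuous_const.mul continuous_id))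
  have hD' : Integrable (fun Q => D (γ 0 * Q)) μ :=
    hint _ (hD.comp (continuous_const.mul continuous_id))
  have key := (hasDerivAt_integral_of_dominated_loc_of_deriv_le (μ := μ)
    (bound := fun _ => C) (F := fun t Q => F (γ t * Q))
    (F' := fun t Q => D (γ t * Q)) (x₀ := (0 : ℝ)) Filter.univ_mem
    (Filter.Eventually.of_forall fun t => (hF' t).aestronglyMeasurable) (hF' 0)
    hD'.aestronglyMeasurable
    (Filter.Eventually.of_forall fun Q t _ => hC _ ⟨_, rfl⟩)
    (integrable_const C)
    (Filter.Eventually.of_forall fun Q t _ => hdiff Q t)).2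
  -- By left invariance the integral of `F (γ t * Q)` does not depend on `t`, so its derivative is
  -- zero.
  simp only [integral_mul_left_eq_self] at key
  exact key.unique (hasDerivAt_const _ _)

variable {N : ℕ} {k : GaugeKind} {E : Type*} [DecidableEq E] [Fintype E]

theorem HasGrad.integral_eq_zero {e : E} {F : GaugeField N k E → ℂ}
    {D : GaugeField N k E → Matrix (Fin N) (Fin N) ℂ → ℂ} (h : HasGrad e F D)
    {X : Matrix (Fin N) (Fin N) ℂ} (hX : X ∈ lieSet N k) :
    ∫ Q, D Q X ∂(haarField N k E) = 0 := by
  obtain ⟨γ, hmul, hder⟩ := exists_oneParam hX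
  have h0 : γ 0 = 1 := by simpa using hmul 0 0
  refine integral_deriv_eq_zero (haarField N k E) h.cont (h.cont_grad X)
    (γ := fun t => Pi.mulSingle e (γ t)) (fun s t => ?_) (h.deriv γ X hX.1 h0 hder)
  rw [hmul, Pi.mulSingle_mul]

end IntegrationByParts

/-! The Yang–Mills expectation -/

/-- Matrix units are not skew-Hermitian, so integration by parts does not reach them directly.
Writing `X` as `(X - X*)/2` plus `i` times `-i(X + X*)/2` gives two skew-Hermitian parts, both
traceless if `X` is. -/
theorem exists_lieSet_decomposition {N : ℕ} {k : GaugeKind} {X : Matrix (Fin N) (Fin N) ℂ}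
    (hX : k = .SU → X.trace = 0) :
    ∃ A ∈ lieSet N k, ∃ B ∈ lieSet N k, X = A + Complex.I • B := by
  set A : Matrix (Fin N) (Fin N) ℂ := (1 / 2 : ℂ) • (X - X.conjTranspose) with hA
  set B : Matrix (Fin N) (Fin N) ℂ := (-Complex.I / 2) • (X + X.conjTranspose) with hB
  have hXAB : X = A + Complex.I • B := by
    rw [hA, hB, smul_smul]
    have : Complex.I * (-Complex.I / 2) = 1 / 2 := by
      rw [mul_div_assoc', mul_neg, Complex.I_mul_I]; norm_num
    rw [this, ← smul_add, sub_add_add_cancel, ← two_smul ℂ X, smul_smul]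
    norm_num
  have htr : k = .SU → X.conjTranspose.trace = 0 := fun hk => by
    rw [Matrix.trace_conjTranspose, hX hk, star_zero]
  have hAmem : A ∈ lieSet N k := by
    refine ⟨?_, fun hk => ?_⟩
    · rw [hA, Matrix.conjTranspose_smul, Matrix.conjTranspose_sub,
        Matrix.conjTranspose_conjTranspose, ← smul_neg, neg_sub]
      congr 1
      simp
    · rw [hA, Matrix.trace_smul, Matrix.trace_sub, hX hk, htr hk]
      simp
  have hBmem : B ∈ lieSet N k := by
    refine ⟨?_, fun hk => ?_⟩
    · rw [hB, Matrix.conjTranspose_smul, Matrix.conjTranspose_add,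
        Matrix.conjTranspose_conjTranspose, ← neg_smul, add_comm X]
      congr 1
      simp [neg_div]
    · rw [hB, Matrix.trace_smul, Matrix.trace_add, hX hk, htr hk]
      simp
  exact ⟨A, hAmem, B, hBmem, hXAB⟩

section Expectation

variable {V E F : Type*} [Fintype F] (K : TwoComplex V E F) (N : ℕ) (k : GaugeKind)
  (β : ℝ)

section

variable [Fintype E]

instance ymMeasure_isFiniteMeasure : IsFiniteMeasure (ymMeasure K N k β) := by
  unfold ymMeasure; infer_instance

variable {N k}


theorem _root_.Continuous.integrable_ymMeasure {f : GaugeField N k E → ℂ} (hf : Continuous f) :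
    Integrable f (ymMeasure K N k β) :=
  hf.integrable_of_hasCompactSupport (HasCompactSupport.of_compactSpace f)

theorem ymExp_add {f g : GaugeField N k E → ℂ} (hf : Continuous f) (hg : Continuous g) :
    ymExp K N k β (fun Q => f Q + g Q) = ymExp K N k β f + ymExp K N k β g :=
  integral_add (hf.integrable_ymMeasure K β) (hg.integrable_ymMeasure K β)

theorem ymExp_sub {f g : GaugeField N k E → ℂ} (hf : Continuous f) (hg : Continuous g) :
    ymExp K N k β (fun Q => f Q - g Q) = ymExp K N k β f - ymExp K N k β g :=
  integral_sub (hf.integrable_ymMeasure K β) (hg.integrable_ymMeasure K β)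

theorem ymExp_const_mul (c : ℂ) (f : GaugeField N k E → ℂ) :
    ymExp K N k β (fun Q => c * f Q) = c * ymExp K N k β f :=
  integral_const_mul c f

theorem ymExp_sum {ι : Type*} (s : Finset ι) {f : ι → GaugeField N k E → ℂ}
    (hf : ∀ i, Continuous (f i)) :
    ymExp K N k β (fun Q => ∑ i ∈ s, f i Q) = ∑ i ∈ s, ymExp K N k β (f i) :=
  integral_finsetSum s fun i _ => (hf i).integrable_ymMeasure K β

/-- The normalisation enters only as the constant factor `Z⁻¹`, which cannot spoil a vanishing
integral. -/
theorem ymExp_eq_zero {f : GaugeField N k E → ℂ}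
    (h : ∫ Q, Complex.exp (action K N k β Q) * f Q ∂(haarField N k E) = 0) :
    ymExp K N k β f = 0 := by
  unfold ymExp ymMeasure
  rw [integral_tilted]
  have : ∀ Q : GaugeField N k E,
      (Real.exp (action K N k β Q) /
        ∫ Q, Real.exp (action K N k β Q) ∂(Measure.pi fun _ : E => haar N k)) • f Q
      = (((∫ Q, Real.exp (action K N k β Q) ∂(Measure.pi fun _ : E => haar N k))⁻¹ : ℝ) : ℂ) *
        (Complex.exp (action K N k β Q) * f Q) := by
    intro Q
    rw [Complex.real_smul]
    push_cast
    ring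
  simp only [this]
  rw [integral_const_mul, h, mul_zero]

end

variable [DecidableEq E]

variable {N k}

/-- The derivative of the action when `Q e` moves in the direction `X * Q e`. -/
noncomputable def gradAction (e : E) (Q : GaugeField N k E) (X : Matrix (Fin N) (Fin N) ℂ) : ℂ :=
  (β : ℂ) * N / 2 * ∑ p : F,
    ((gradHol e Q X (K.bdry p)).trace + (gradHol e Q X (K.bdry p).inv).trace)

/-- The real part is rewritten as `(W_p + W_{p⁻¹})/2`, using that reversing a loop conjugates its
trace. No complex conjugation is left, so the gradient is complex linear in the direction; this is
also where both orientations of each plaquette appear. -/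
theorem hasGrad_action (e : E) :
    HasGrad (N := N) (k := k) e (fun Q => (action K N k β Q : ℂ)) (gradAction K β e) := by
  have h : (fun Q : GaugeField N k E => (action K N k β Q : ℂ)) = fun Q =>
      (β : ℂ) * N / 2 * ∑ p : F, (wilson (K.bdry p) Q + wilson (K.bdry p).inv Q) := by
    funext Q
    rw [action]
    push_cast
    rw [div_mul_eq_mul_div, mul_div_assoc, Finset.sum_div]
    congr 1
    refine Finset.sum_congr rfl fun p _ => ?_
    rw [Complex.re_eq_add_conj, wilson_inv]
    rfl
  rw [h]
  exact HasGrad.const_mul _ (HasGrad.sum fun p _ => (hasGrad_wilson e _).add (hasGrad_wilson e _))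

theorem gradAction_add (e : E) (Q : GaugeField N k E) (X Y : Matrix (Fin N) (Fin N) ℂ) :
    gradAction K β e Q (X + Y) = gradAction K β e Q X + gradAction K β e Q Y := by
  simp only [gradAction, gradHol_add, Matrix.trace_add, ← mul_add, ← Finset.sum_add_distrib]
  congr 1
  exact Finset.sum_congr rfl fun p _ => by ring

theorem gradAction_smul (e : E) (c : ℂ) (Q : GaugeField N k E) (X : Matrix (Fin N) (Fin N) ℂ) :
    gradAction K β e Q (c • X) = c * gradAction K β e Q X := by
  simp only [gradAction, gradHol_smul, Matrix.trace_smul, smul_eq_mul, ← mul_add, ← Finset.mul_sum]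
  ring

variable [Fintype E]

/-- The Schwinger–Dyson equation in the direction of the Lie algebra of the structure group. -/
theorem ymExp_grad_of_mem_lieSet {e : E} {f : GaugeField N k E → ℂ}
    {D : GaugeField N k E → Matrix (Fin N) (Fin N) ℂ → ℂ} (h : HasGrad e f D)
    {X : Matrix (Fin N) (Fin N) ℂ} (hX : X ∈ lieSet N k) :
    ymExp K N k β (fun Q => D Q X + f Q * gradAction K β e Q X) = 0 := by
  apply ymExp_eq_zero
  rw [← (h.mul (hasGrad_action K β e).cexp).integral_eq_zero hX]
  congr 1
  funext Q
  ring

/-- The Schwinger–Dyson equation in the direction of the complexified Lie algebra. -/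
theorem ymExp_grad {e : E} {f : GaugeField N k E → ℂ}
    {D : GaugeField N k E → Matrix (Fin N) (Fin N) ℂ → ℂ} (h : HasGrad e f D)
    (hadd : ∀ Q X Y, D Q (X + Y) = D Q X + D Q Y) (hsmul : ∀ Q (c : ℂ) X, D Q (c • X) = c * D Q X)
    {X : Matrix (Fin N) (Fin N) ℂ} (hX : k = .SU → X.trace = 0) :
    ymExp K N k β (fun Q => D Q X + f Q * gradAction K β e Q X) = 0 := by
  obtain ⟨A, hAmem, B, hBmem, rfl⟩ := exists_lieSet_decomposition hX
  have hcont : ∀ Y, Continuous fun Q => D Q Y + f Q * gradAction K β e Q Y := fun Y =>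
    (h.cont_grad Y).add (h.cont.mul ((hasGrad_action K β e).cont_grad Y))
  calc ymExp K N k β (fun Q => D Q (A + Complex.I • B)
          + f Q * gradAction K β e Q (A + Complex.I • B))
      = ymExp K N k β (fun Q => (D Q A + f Q * gradAction K β e Q A)
          + Complex.I * (D Q B + f Q * gradAction K β e Q B)) := by
        congr 1
        funext Q
        rw [hadd, hsmul, gradAction_add, gradAction_smul]
        ring
    _ = 0 := by
        rw [ymExp_add K β (hcont A) ((hcont B).const_mul _), ymExp_const_mul,
          ymExp_grad_of_mem_lieSet K β h hAmem, ymExp_grad_of_mem_lieSet K β h hBmem]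
        simp

end Expectation

/-! Winding numbers and occurrences -/

section Winding

theorem take_append_getElem_append_drop {E : Type*} (w : Word E) (x : Fin w.length) :
    w.take x ++ ([w[x]] ++ w.drop (x + 1)) = w := by
  simp


variable {E : Type*} [DecidableEq E] (e : E)

theorem winding_eq_sum (w : Word E) : winding e w = ∑ x ∈ occ e w, (sgn w x : ℤ) := by
  simp only [winding, occPos, occNeg, occ, Finset.card_filter, Finset.sum_filter, Nat.cast_sum,
    ← Finset.sum_sub_distrib]
  refine Finset.sum_congr rfl fun x _ => ?_
  by_cases h : w[(x : ℕ)].1 = e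
  · rcases Int.units_eq_one_or (sgn w x) with h' | h' <;> simp [h, h']
  · simp [h]

theorem winding_nil : winding e ([] : Word E) = 0 := by
  simp [winding_eq_sum, occ]

theorem winding_cons (a : OEdge E) (w : Word E) :
    winding e (a :: w) = (if a.1 = e then (a.2 : ℤ) else 0) + winding e w := by
  simp only [winding_eq_sum, occ, Finset.sum_filter]
  exact (Fin.sum_univ_succ (n := w.length) _).trans rfl

theorem winding_append (w₁ w₂ : Word E) : winding e (w₁ ++ w₂) = winding e w₁ + winding e w₂ := by
  induction w₁ with
  | nil => simp [winding_nil]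
  | cons a w ih => rw [List.cons_append, winding_cons, ih, winding_cons, add_assoc]

theorem winding_inv (w : Word E) : winding e w.inv = -winding e w := by
  induction w with
  | nil => simp [Word.inv, winding_nil]
  | cons a w ih =>
    rw [Word.inv_cons, winding_append, ih, winding_cons, winding_cons, winding_nil]
    split_ifs <;> simp

theorem winding_eq_zero_of_occ_eq_empty {w : Word E} (h : ¬(occ e w).Nonempty) :
    winding e w = 0 := by
  rw [winding_eq_sum, Finset.not_nonempty_iff_eq_empty.mp h, Finset.sum_empty]

variable {e}

theorem getElem_eq_of_mem_occ {w : Word E} {x : Fin w.length} (h : x ∈ occ e w) :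
    w[x] = (e, sgn w x) :=
  Prod.ext (Finset.mem_filter.mp h).2 rfl

/-- The loop `w`, cut open at the edge `x` so that the tail of the positively oriented edge at
position `x` is the base point. -/
def root (w : Word E) (x : Fin w.length) : Word E :=
  if sgn w x = 1 then excise w x ++ [w[x]] else [w[x]] ++ excise w x

theorem winding_root (w : Word E) (x : Fin w.length) : winding e (root w x) = winding e w := by
  conv_rhs => rw [← take_append_getElem_append_drop w x]
  unfold root excise
  split_ifs <;> simp only [winding_append] <;> ring

end Winding

/-! The gradient of a holonomy, position by position -/

section GradientFormulas

variable {N : ℕ} {k : GaugeKind} {E : Type*} [DecidableEq E] (e : E) (Q : GaugeField N k E)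
  (X : Matrix (Fin N) (Fin N) ℂ)

theorem gradHol_append (w₁ w₂ : Word E) :
    gradHol e Q X (w₁ ++ w₂) = gradHol e Q X w₂ * holMat Q w₁ + holMat Q w₂ * gradHol e Q X w₁ := by
  induction w₁ with
  | nil => simp [gradHol]
  | cons a w ih =>
    simp only [List.cons_append, gradHol, ih, holMat_cons, holMat_append, add_mul, mul_add,
      mul_assoc, add_assoc]

theorem gradHol_singleton (a : OEdge E) : gradHol e Q X [a] = gradStep e Q X a := by
  simp [gradHol]

/-- A scalar commutes with every factor, so each occurrence of `e^{±1}` reproduces the whole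
holonomy with its sign. -/
theorem gradHol_one (w : Word E) : gradHol e Q 1 w = (winding e w : ℂ) • holMat Q w := by
  induction w with
  | nil => simp [gradHol, winding_nil]
  | cons a w ih =>
    have h : gradStep e Q 1 a = ((if a.1 = e then (a.2 : ℤ) else 0 : ℤ) : ℂ) • stepMat Q a := by
      unfold gradStep
      rcases Int.units_eq_one_or a.2 with h' | h' <;> split_ifs <;> simp_all
    rw [gradHol, ih, h, winding_cons, holMat_cons]
    push_cast
    rw [add_smul, Matrix.smul_mul, Matrix.mul_smul, add_comm]

/-- The contribution of position `y` to the gradient of the holonomy. -/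
def gradTerm (w : Word E) (y : ℕ) : Matrix (Fin N) (Fin N) ℂ :=
  -- Positions are natural numbers, with value 0 past the end, so that sums over ranges can be split
  -- and shifted without dependent indices.
  w[y]?.elim 0 fun a => holMat Q (w.drop (y + 1)) * gradStep e Q X a * holMat Q (w.take y)

theorem gradHol_eq_sum_range (w : Word E) :
    gradHol e Q X w = ∑ y ∈ Finset.range w.length, gradTerm e Q X w y := by
  induction w with
  | nil => simp [gradHol]
  | cons a w ih =>
    rw [List.length_cons, Finset.sum_range_succ', gradHol, ih, Finset.sum_mul]
    congr 1
    · refine Finset.sum_congr rfl fun y hy => ?_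
      have hy' : y < w.length := Finset.mem_range.mp hy
      simp [gradTerm, holMat_cons, mul_assoc, hy']
    · simp [gradTerm]

theorem gradHol_eq_sum (w : Word E) :
    gradHol e Q X w = ∑ y : Fin w.length,
      holMat Q (w.drop (y + 1)) * gradStep e Q X w[y] * holMat Q (w.take y) := by
  rw [gradHol_eq_sum_range, Finset.sum_range]
  exact Finset.sum_congr rfl fun y _ => by simp [gradTerm]

/-- Once `x` has been removed, an insertion at `y` cuts the rest of the loop into the arc from `x`
to `y` and the arc from `y` to `x`. -/
theorem gradHol_excise (w : Word E) (x : Fin w.length) :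
    gradHol e Q X (excise w x) = ∑ y ∈ Finset.univ.erase x,
      holMat Q (arc w y x) * gradStep e Q X w[y] * holMat Q (arc w x y) := by
  let f : ℕ → Matrix (Fin N) (Fin N) ℂ := fun y => if h : y < w.length then
    if (⟨y, h⟩ : Fin w.length) = x then 0 else
      holMat Q (arc w ⟨y, h⟩ x) * gradStep e Q X w[y] * holMat Q (arc w x ⟨y, h⟩) else 0
  have hx := x.2
  have hlen : w.length = (x : ℕ) + (1 + (w.length - (x + 1))) := by omega
  have hf : ∑ y ∈ Finset.univ.erase x,
      holMat Q (arc w y x) * gradStep e Q X w[y] * holMat Q (arc w x y)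
      = ∑ y ∈ Finset.range w.length, f y := by
    rw [Finset.sum_range, ← Finset.sum_erase Finset.univ (a := x) (f := fun y : Fin _ => f y)]
    · refine Finset.sum_congr rfl fun y hy => ?_
      simp [f, Finset.ne_of_mem_erase hy]
    · simp [f]
  -- The positions are grouped as before `x`, equal to `x` (where `f` is 0), and after `x`. The
  -- first group lies in the final piece `w.take x` of the excised word, the last in its initial
  -- piece `w.drop (x + 1)`.
  rw [hf, hlen, Finset.sum_range_add, Finset.sum_range_add]
  have h0 : ∑ y ∈ Finset.range 1, f (x + y) = 0 := by simp [f]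
  rw [h0, zero_add, excise, gradHol_append, gradHol_eq_sum_range, gradHol_eq_sum_range,
    Finset.sum_mul, Finset.mul_sum, List.length_take, List.length_drop, min_eq_left hx.le]
  congr 1
  · refine Finset.sum_congr rfl fun y hy => ?_
    have hyx : y < x := Finset.mem_range.mp hy
    have hy' : y < w.length := hyx.trans hx
    have h1 : (⟨y, hy'⟩ : Fin w.length) ≠ x := fun h => hyx.ne (congrArg Fin.val h)
    have h2 : (⟨y, hy'⟩ : Fin w.length) < x := hyx
    simp [f, gradTerm, hy', h1, arc, h2, h2.not_gt, List.getElem?_take_of_lt hyx, List.take_take,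
      min_eq_left hyx.le, holMat_append, mul_assoc]
  · refine Finset.sum_congr rfl fun j hj => ?_
    have hj' := Finset.mem_range.mp hj
    have hy' : (x : ℕ) + (1 + j) < w.length := by omega
    have h1 : (⟨x + (1 + j), hy'⟩ : Fin w.length) ≠ x := fun h => by
      have := congrArg Fin.val h
      simp at this
    have h2 : x < (⟨x + (1 + j), hy'⟩ : Fin w.length) := by
      rw [Fin.lt_def]; simp only; omega
    have h3 : (x : ℕ) + 1 + j = x + (1 + j) := by omega
    have h4 : (x : ℕ) + 1 + (j + 1) = x + (1 + j) + 1 := by omega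
    have h5 : x + (1 + j) - (x + 1 : ℕ) = j := by omega
    simp [f, gradTerm, hy', h1, arc, h2, h2.not_gt, List.drop_drop, h3, h4, h5,
      holMat_append, mul_assoc, List.drop_take]

variable {e}

theorem gradStep_of_mem_occ_of_pos {w : Word E} {x : Fin w.length} (h : x ∈ occ e w)
    (h1 : sgn w x = 1) : gradStep e Q X w[x] = X * stepMat Q (e, 1) := by
  rw [getElem_eq_of_mem_occ h, h1]; simp [gradStep]

theorem gradStep_of_mem_occ_of_neg {w : Word E} {x : Fin w.length} (h : x ∈ occ e w)
    (h1 : sgn w x = -1) : gradStep e Q X w[x] = -(stepMat Q (e, -1) * X) := by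
  have hne : (-1 : ℤˣ) ≠ 1 := by decide
  rw [getElem_eq_of_mem_occ h, h1]; simp [gradStep, hne]

theorem gradStep_of_notMem_occ {w : Word E} {x : Fin w.length} (h : x ∉ occ e w) :
    gradStep e Q X w[x] = 0 := by
  have : ¬w[x].1 = e := by simpa [occ] using h
  rw [gradStep, if_neg this]

theorem holMat_root_of_pos {w : Word E} {x : Fin w.length} (h : x ∈ occ e w)
    (h1 : sgn w x = 1) : holMat Q (root w x) = stepMat Q (e, 1) * holMat Q (excise w x) := by
  rw [root, if_pos h1, holMat_append, holMat_singleton, getElem_eq_of_mem_occ h, h1]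

theorem holMat_root_of_neg {w : Word E} {x : Fin w.length} (h : x ∈ occ e w)
    (h1 : sgn w x = -1) : holMat Q (root w x) = holMat Q (excise w x) * stepMat Q (e, -1) := by
  have hne : (-1 : ℤˣ) ≠ 1 := by decide
  rw [root, h1, if_neg hne, holMat_append, holMat_singleton, getElem_eq_of_mem_occ h, h1]

omit [DecidableEq E] in
theorem wilson_root (w : Word E) (x : Fin w.length) : wilson (root w x) Q = wilson w Q := by
  conv_rhs => rw [← take_append_getElem_append_drop w x]
  unfold root excise
  split_ifs <;> simp only [wilson_eq_trace, holMat_append, mul_assoc]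
  · rw [Matrix.trace_mul_comm (holMat Q (List.drop _ _)), mul_assoc]
  · rw [Matrix.trace_mul_comm (holMat Q (List.take _ _)), mul_assoc]

end GradientFormulas

/-! Traces of gradients, and contraction over matrix units -/

section Traces

variable {N : ℕ} {k : GaugeKind} {E : Type*} (Q : GaugeField N k E)

theorem sgn_cases (w : Word E) (x : Fin w.length) : sgn w x = 1 ∨ sgn w x = -1 :=
  Int.units_eq_one_or _

theorem stepMat_mul_stepMat_neg (e : E) : stepMat Q (e, 1) * stepMat Q (e, -1) = 1 :=
  stepMat_mul_neg Q (e, 1)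

theorem stepMat_neg_mul_stepMat (e : E) : stepMat Q (e, -1) * stepMat Q (e, 1) = 1 :=
  stepMat_neg_mul Q (e, 1)

variable [DecidableEq E] {e : E}
  (X : Matrix (Fin N) (Fin N) ℂ)

/-- `X` stands to the left of the factor of `e` and to the right of the factor of `e⁻¹`, in both
cases at the end point of `e`. `root` bases the loop there, so cyclicity of the trace gives one
formula for both signs. -/
theorem trace_gradHol (w : Word E) : (gradHol e Q X w).trace =
    ∑ y ∈ occ e w, ((sgn w y : ℤ) : ℂ) * (X * holMat Q (root w y)).trace := by
  rw [gradHol_eq_sum, Matrix.trace_sum, ← Finset.sum_subset (Finset.subset_univ (occ e w))]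
  · refine Finset.sum_congr rfl fun y hy => ?_
    have hcyc : ∀ A : Matrix (Fin N) (Fin N) ℂ,
        (holMat Q (w.drop (y + 1)) * A * holMat Q (w.take y)).trace
          = (A * holMat Q (excise w y)).trace := fun A => by
      rw [excise, holMat_append, mul_assoc, Matrix.trace_mul_comm, mul_assoc]
    rw [hcyc]
    rcases sgn_cases w y with h | h
    · rw [gradStep_of_mem_occ_of_pos Q X hy h, holMat_root_of_pos Q hy h, h]
      simp [mul_assoc]
    · rw [gradStep_of_mem_occ_of_neg Q X hy h, holMat_root_of_neg Q hy h, h, neg_mul,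
        Matrix.trace_neg, mul_assoc, Matrix.trace_mul_comm]
      simp [mul_assoc]
  · intro y _ hy
    rw [gradStep_of_notMem_occ Q X hy]; simp

theorem gradStep_neg (a : OEdge E) : gradStep e Q X (a.1, -a.2) =
    -(stepMat Q (a.1, -a.2) * gradStep e Q X a * stepMat Q (a.1, -a.2)) := by
  have hne : (-1 : ℤˣ) ≠ 1 := by decide
  have h1 := stepMat_mul_stepMat_neg Q a.1
  have h2 := stepMat_neg_mul_stepMat Q a.1
  obtain ⟨e', ω⟩ := a
  unfold gradStep
  rcases Int.units_eq_one_or ω with rfl | rfl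
  · split_ifs <;> simp_all [mul_assoc]
  · split_ifs <;> simp_all [← mul_assoc]

/-- This is `d(Q⁻¹) = -Q⁻¹ dQ Q⁻¹`. It is proved by algebra on words, hence holds for every complex
`X` and not only for directions of one-parameter subgroups. -/
theorem gradHol_inv (w : Word E) :
    gradHol e Q X w.inv = -(holMat Q w.inv * gradHol e Q X w * holMat Q w.inv) := by
  induction w with
  | nil => simp [gradHol, Word.inv]
  | cons a w ih =>
    set S := stepMat Q a
    set S' := stepMat Q (a.1, -a.2)
    set W := holMat Q w
    set W' := holMat Q (Word.inv w)
    set G := gradHol e Q X w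
    have h1 : S * S' = 1 := stepMat_mul_neg Q a
    have h2 : W' * W = 1 := holMat_inv_mul Q w
    have hA : S' * W' * (G * S) * (S' * W') = S' * (W' * G * W') := by
      calc _ = S' * W' * G * (S * S') * W' := by simp only [mul_assoc]
        _ = _ := by rw [h1]; simp only [mul_one, mul_assoc]
    have hB : S' * W' * (W * gradStep e Q X a) * (S' * W')
        = S' * gradStep e Q X a * S' * W' := by
      calc _ = S' * (W' * W) * gradStep e Q X a * (S' * W') := by simp only [mul_assoc]
        _ = _ := by rw [h2]; simp only [mul_one, mul_assoc]
    rw [Word.inv_cons, gradHol_append, gradHol_singleton, ih, gradStep_neg, holMat_append,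
      holMat_singleton, gradHol, mul_add, add_mul, hA, hB, neg_mul, mul_neg, neg_add, add_comm]

theorem holMat_root_inv_of_pos {w : Word E} {x : Fin w.length} (h : x ∈ occ e w)
    (h1 : sgn w x = 1) :
    holMat Q (root w x).inv = holMat Q (excise w x).inv * stepMat Q (e, -1) := by
  rw [holMat_inv, holMat_root_of_pos Q h h1, Matrix.conjTranspose_mul, ← holMat_inv]
  simp [stepMat, toMat_inv]

theorem holMat_root_inv_of_neg {w : Word E} {x : Fin w.length} (h : x ∈ occ e w)
    (h1 : sgn w x = -1) :
    holMat Q (root w x).inv = stepMat Q (e, 1) * holMat Q (excise w x).inv := by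
  rw [holMat_inv, holMat_root_of_neg Q h h1, Matrix.conjTranspose_mul, ← holMat_inv]
  simp [stepMat, toMat_inv]

/-- Indexing by the occurrences in `w` rather than in `w.inv` lets the two orientations of a
plaquette be combined position by position. The sign is reversed because each edge is traversed
backwards. -/
theorem trace_gradHol_inv (w : Word E) : (gradHol e Q X w.inv).trace =
    -∑ y ∈ occ e w, ((sgn w y : ℤ) : ℂ) * (X * holMat Q (root w y).inv).trace := by
  rw [gradHol_inv, gradHol_eq_sum, Finset.mul_sum, Finset.sum_mul, Matrix.trace_neg,
    Matrix.trace_sum, ← Finset.sum_subset (Finset.subset_univ (occ e w))]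
  · congr 1
    refine Finset.sum_congr rfl fun y hy => ?_
    have hw : holMat Q w.inv = holMat Q (Word.inv (w.take y)) * stepMat Q (e, -(sgn w y))
        * holMat Q (Word.inv (w.drop (y + 1))) := by
      conv_lhs => rw [← take_append_getElem_append_drop w y]
      rw [holMat_inv, holMat_append, holMat_append, holMat_singleton, getElem_eq_of_mem_occ hy,
        Matrix.conjTranspose_mul, Matrix.conjTranspose_mul, ← holMat_inv, ← holMat_inv]
      simp [stepMat, toMat_inv, mul_assoc]
    have hex : holMat Q (excise w y).inv =
        holMat Q (Word.inv (w.drop (y + 1))) * holMat Q (Word.inv (w.take y)) := by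
      rw [excise, holMat_inv, holMat_append, Matrix.conjTranspose_mul, ← holMat_inv, ← holMat_inv]
    -- On either side of the insertion at `y` the reversed loop cancels the arc next to it, leaving
    -- the inverse edge on both sides and the reversed excised loop.
    have hcyc : ∀ A : Matrix (Fin N) (Fin N) ℂ,
        (holMat Q w.inv * (holMat Q (w.drop (y + 1)) * A * holMat Q (w.take y))
          * holMat Q w.inv).trace
          = (stepMat Q (e, -(sgn w y)) * A * stepMat Q (e, -(sgn w y))
            * holMat Q (excise w y).inv).trace := fun A => by
      have e1 : holMat Q w.inv * holMat Q (w.drop (y + 1))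
          = holMat Q (Word.inv (w.take y)) * stepMat Q (e, -(sgn w y)) := by
        rw [hw, mul_assoc _ _ (holMat Q (w.drop (y + 1))), holMat_inv_mul, mul_one]
      have e2 : holMat Q (w.take y) * holMat Q w.inv
          = stepMat Q (e, -(sgn w y)) * holMat Q (Word.inv (w.drop (y + 1))) := by
        rw [hw, ← mul_assoc, ← mul_assoc, holMat_mul_inv, one_mul]
      calc _ = ((holMat Q w.inv * holMat Q (w.drop (y + 1))) * A
            * (holMat Q (w.take y) * holMat Q w.inv)).trace := by simp only [mul_assoc]
        _ = _ := by
          rw [e1, e2, hex]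
          simp only [mul_assoc]
          rw [Matrix.trace_mul_comm]
          simp only [mul_assoc]
    rw [hcyc]
    rcases sgn_cases w y with h | h
    · rw [gradStep_of_mem_occ_of_pos Q X hy h, holMat_root_inv_of_pos Q hy h, h]
      calc _ = (stepMat Q (e, -1) * (X * (stepMat Q (e, 1) * stepMat Q (e, -1))
            * holMat Q (excise w y).inv)).trace := by simp only [mul_assoc]
        _ = _ := by
          rw [stepMat_mul_stepMat_neg, Matrix.trace_mul_comm]
          simp [mul_assoc]
    · rw [gradStep_of_mem_occ_of_neg Q X hy h, holMat_root_inv_of_neg Q hy h, h, neg_neg,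
        mul_neg, neg_mul, neg_mul, Matrix.trace_neg, ← mul_assoc (stepMat Q (e, 1)),
        stepMat_mul_stepMat_neg]
      simp [mul_assoc]
  · intro y _ hy
    rw [gradStep_of_notMem_occ Q X hy]; simp

/-- Contraction over matrix units turns `P * X * R` into `tr P * tr R`. -/
theorem sum_mul_single_mul_apply (P R : Matrix (Fin N) (Fin N) ℂ) :
    ∑ a : Fin N, ∑ b : Fin N, (P * Matrix.single a b (1 : ℂ) * R : Matrix (Fin N) (Fin N) ℂ) a b = P.trace * R.trace := by
  simp only [Matrix.trace, Matrix.diag, Finset.sum_mul_sum]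
  refine Finset.sum_congr rfl fun a _ => Finset.sum_congr rfl fun b _ => ?_
  rw [mul_assoc, Matrix.mul_apply, Finset.sum_eq_single a]
  · simp
  · intro c _ hc
    simp [Matrix.single_mul_apply_of_ne _ _ _ _ _ hc]
  · simp

/-- `tr(E_ab B) = B_ba`; this contraction joins two loops into one. -/
theorem sum_apply_mul_trace_single (A B : Matrix (Fin N) (Fin N) ℂ) :
    ∑ a : Fin N, ∑ b : Fin N, A a b * (Matrix.single a b 1 * B).trace = (A * B).trace := by
  rw [Matrix.trace]
  simp only [Matrix.trace_single_mul, Matrix.diag, Matrix.mul_apply, one_smul]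

end Traces

/-! Splittings and mergers as contractions -/

section Contractions

variable {N : ℕ} {k : GaugeKind} {E : Type*} [DecidableEq E] {e : E} (Q : GaugeField N k E)

theorem holMat_posSplit (w : Word E) (x : Fin w.length) {y : Fin w.length} (hy : y ∈ occ e w) :
    holMat Q (posSplit w x y) = stepMat Q (e, sgn w y) * holMat Q (arc w x y) := by
  rw [posSplit, holMat_append, holMat_singleton, getElem_eq_of_mem_occ hy]

/-- The product of the two Wilson loops obtained by splitting `w` at `x, y`. -/
def splitProd (w : Word E) (x y : Fin w.length) (Q : GaugeField N k E) : ℂ :=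
  if sgn w x * sgn w y = 1 then wilson (posSplit w x y) Q * wilson (posSplit w y x) Q
  else wilson (negSplit w x y) Q * wilson (negSplit w y x) Q

omit [DecidableEq E] in
theorem continuous_splitProd (w : Word E) (x y : Fin w.length) :
    Continuous (splitProd (N := N) (k := k) w x y) := by
  unfold splitProd
  split_ifs <;> fun_prop

/-- `L` and `R` carry the edge at `x`, to the left of the excised holonomy if `ω_x = 1` and to the
right if `ω_x = -1`. Contraction at `y` separates the two arcs into two traces. For equal signs each
trace keeps one edge factor; for opposite signs both factors fall into the same trace and cancel. -/
theorem contract_split_term {w : Word E} {x y : Fin w.length} (hx : x ∈ occ e w)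
    (hy : y ∈ occ e w) (L R : Matrix (Fin N) (Fin N) ℂ)
    (hL : L = if sgn w x = 1 then stepMat Q (e, 1) else 1)
    (hR : R = if sgn w x = 1 then 1 else stepMat Q (e, -1)) :
    ∑ a : Fin N, ∑ b : Fin N, (L * (holMat Q (arc w y x) *
        gradStep e Q (Matrix.single a b 1) w[y] * holMat Q (arc w x y)) * R) a b
      = ((sgn w y : ℤ) : ℂ) * splitProd w x y Q := by
  have hne : (-1 : ℤˣ) ≠ 1 := by decide
  subst hL hR
  rcases sgn_cases w y with h2 | h2
  · have key : ∀ (A B : Matrix (Fin N) (Fin N) ℂ), ∑ a : Fin N, ∑ b : Fin N,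
        (A * (holMat Q (arc w y x) * gradStep e Q (Matrix.single a b 1) w[y]
          * holMat Q (arc w x y)) * B) a b
        = (A * holMat Q (arc w y x)).trace
          * (stepMat Q (e, 1) * holMat Q (arc w x y) * B).trace := by
      intro A B
      rw [← sum_mul_single_mul_apply]
      simp only [gradStep_of_mem_occ_of_pos Q _ hy h2, mul_assoc]
    rw [key, splitProd, wilson_eq_trace, wilson_eq_trace, wilson_eq_trace, wilson_eq_trace,
      holMat_posSplit Q w x hy, holMat_posSplit Q w y hx, negSplit, negSplit, h2]
    rcases sgn_cases w x with h1 | h1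
    · simp [h1, mul_comm]
    · simp only [h1, if_neg hne, one_mul, mul_one, Units.val_one, Int.cast_one]
      rw [Matrix.trace_mul_comm _ (stepMat Q (e, -1)), ← mul_assoc, stepMat_neg_mul_stepMat,
        one_mul, mul_comm]
  · have key : ∀ (A B : Matrix (Fin N) (Fin N) ℂ), ∑ a : Fin N, ∑ b : Fin N,
        (A * (holMat Q (arc w y x) * gradStep e Q (Matrix.single a b 1) w[y]
          * holMat Q (arc w x y)) * B) a b
        = -((A * holMat Q (arc w y x) * stepMat Q (e, -1)).trace
          * (holMat Q (arc w x y) * B).trace) := by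
      intro A B
      rw [← sum_mul_single_mul_apply]
      simp only [gradStep_of_mem_occ_of_neg Q _ hy h2, mul_assoc, mul_neg, neg_mul,
        Matrix.neg_apply, Finset.sum_neg_distrib]
    rw [key, splitProd, wilson_eq_trace, wilson_eq_trace, wilson_eq_trace, wilson_eq_trace,
      holMat_posSplit Q w x hy, holMat_posSplit Q w y hx, negSplit, negSplit, h2]
    rcases sgn_cases w x with h1 | h1
    · simp only [h1, one_mul, mul_one, Units.val_neg, Units.val_one, Int.cast_neg, Int.cast_one,
        if_true, if_neg hne]
      rw [Matrix.trace_mul_comm _ (stepMat Q (e, -1)), ← mul_assoc, stepMat_neg_mul_stepMat,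
        one_mul]
      ring
    · simp only [h1, if_neg hne, one_mul, Units.val_neg, Units.val_one, Int.cast_neg,
        Int.cast_one, neg_mul_neg, if_true]
      rw [Matrix.trace_mul_comm _ (stepMat Q (e, -1)), Matrix.trace_mul_comm _ (stepMat Q (e, -1))]
      ring

/-- At `x` itself `X` stands at an end of the whole holonomy, so the contraction gives `tr 1` times
the Wilson loop, hence the factor `N`. Every other occurrence gives a split. -/
theorem contract_gradHol_root {w : Word E} {x : Fin w.length} (hx : x ∈ occ e w) :
    ∑ a : Fin N, ∑ b : Fin N, gradHol e Q (Matrix.single a b 1) (root w x) a b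
      = ((sgn w x : ℤ) : ℂ) * N * wilson w Q
        + ∑ y ∈ (occ e w).erase x, ((sgn w y : ℤ) : ℂ) * splitProd w x y Q := by
  have hne : (-1 : ℤˣ) ≠ 1 := by decide
  have hex : ∀ X, gradHol e Q X (excise w x) = ∑ y ∈ (occ e w).erase x,
      holMat Q (arc w y x) * gradStep e Q X w[y] * holMat Q (arc w x y) := by
    intro X
    rw [gradHol_excise]
    refine (Finset.sum_subset (Finset.erase_subset_erase _ (Finset.subset_univ _)) ?_).symm
    intro y hy hy'
    have : y ∉ occ e w := fun h =>
      hy' (Finset.mem_erase.mpr ⟨Finset.ne_of_mem_erase hy, h⟩)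
    rw [gradStep_of_notMem_occ Q X this]
    simp
  have hroot := wilson_root Q w x
  rw [wilson_eq_trace] at hroot
  have key : ∀ L R : Matrix (Fin N) (Fin N) ℂ,
      (L = if sgn w x = 1 then stepMat Q (e, 1) else 1) →
      (R = if sgn w x = 1 then 1 else stepMat Q (e, -1)) →
      ∑ a : Fin N, ∑ b : Fin N, (L * gradHol e Q (Matrix.single a b 1) (excise w x) * R) a b
        = ∑ y ∈ (occ e w).erase x, ((sgn w y : ℤ) : ℂ) * splitProd w x y Q := by
    intro L R hL hR
    simp only [hex, Finset.mul_sum, Finset.sum_mul, Matrix.sum_apply]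
    rw [Finset.sum_congr rfl fun a _ => Finset.sum_comm, Finset.sum_comm]
    exact Finset.sum_congr rfl fun y hy =>
      contract_split_term Q hx (Finset.mem_of_mem_erase hy) L R hL hR
  rcases sgn_cases w x with h | h
  · have h1 : ∀ X, gradHol e Q X (root w x)
        = 1 * X * holMat Q (root w x) + stepMat Q (e, 1) * gradHol e Q X (excise w x) * 1 := by
      intro X
      rw [holMat_root_of_pos Q hx h, root, if_pos h, gradHol_append, gradHol_singleton,
        gradStep_of_mem_occ_of_pos Q X hx h, holMat_singleton, getElem_eq_of_mem_occ hx, h]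
      simp [mul_assoc]
    simp only [h1, Matrix.add_apply, Finset.sum_add_distrib]
    rw [sum_mul_single_mul_apply, key _ _ (by rw [if_pos h]) (by rw [if_pos h]), hroot, h]
    simp
  · have h1 : ∀ X, gradHol e Q X (root w x)
        = -(holMat Q (root w x) * X * 1) + 1 * gradHol e Q X (excise w x) * stepMat Q (e, -1) := by
      intro X
      rw [holMat_root_of_neg Q hx h, root, h, if_neg hne, gradHol_append, gradHol_singleton,
        gradStep_of_mem_occ_of_neg Q X hx h, holMat_singleton, getElem_eq_of_mem_occ hx, h]
      simp [mul_assoc, add_comm]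
    simp only [h1, Matrix.add_apply, Matrix.neg_apply, Finset.sum_add_distrib,
      Finset.sum_neg_distrib]
    rw [sum_mul_single_mul_apply, key _ _ (by rw [h, if_neg hne]) (by rw [h, if_neg hne]), hroot, h]
    simp [mul_comm]

/-- Both loops are based at the end point of `e`, so they can be concatenated. For equal signs the
two edge factors survive, separated by the excised loops; for opposite signs they become adjacent
and cancel. -/
theorem trace_holMat_root_mul {w₁ w₂ : Word E} {x : Fin w₁.length} {y : Fin w₂.length}
    (hx : x ∈ occ e w₁) (hy : y ∈ occ e w₂) :
    (holMat Q (root w₁ x) * holMat Q (root w₂ y)).trace =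
      if sgn w₁ x * sgn w₂ y = 1 then wilson (posMerge w₁ w₂ x y) Q
      else wilson (negMerge w₁ w₂ x y) Q := by
  have hne : (-1 : ℤˣ) ≠ 1 := by decide
  simp only [wilson_eq_trace, posMerge, negMerge, holMat_append, holMat_singleton,
    getElem_eq_of_mem_occ hx]
  rcases sgn_cases w₁ x with h1 | h1 <;> rcases sgn_cases w₂ y with h2 | h2
  · rw [holMat_root_of_pos Q hx h1, holMat_root_of_pos Q hy h2, Matrix.trace_mul_comm]
    simp [h1, h2, Word.pow, mul_assoc]
  · rw [holMat_root_of_pos Q hx h1, holMat_root_of_neg Q hy h2, Matrix.trace_mul_comm]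
    simp only [h1, h2, Word.pow, one_mul, if_neg hne, neg_neg, if_true]
    rw [mul_assoc, ← mul_assoc (stepMat Q (e, -1)), stepMat_neg_mul_stepMat, one_mul]
  · rw [holMat_root_of_neg Q hx h1, holMat_root_of_pos Q hy h2]
    simp only [h1, h2, Word.pow, mul_one, if_neg hne, neg_neg, if_true]
    rw [mul_assoc, ← mul_assoc (stepMat Q (e, -1)), stepMat_neg_mul_stepMat, one_mul,
      Matrix.trace_mul_comm]
  · rw [holMat_root_of_neg Q hx h1, holMat_root_of_neg Q hy h2]
    simp only [h1, h2, Word.pow, neg_mul_neg, one_mul, if_true]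
    rw [mul_assoc, Matrix.trace_mul_comm]
    simp only [mul_assoc]

theorem trace_holMat_root_mul_inv {w₁ w₂ : Word E} {x : Fin w₁.length} {y : Fin w₂.length}
    (hx : x ∈ occ e w₁) (hy : y ∈ occ e w₂) :
    (holMat Q (root w₁ x) * holMat Q (root w₂ y).inv).trace =
      if sgn w₁ x * sgn w₂ y = 1 then wilson (negMerge w₁ w₂ x y) Q
      else wilson (posMerge w₁ w₂ x y) Q := by
  have hne : (-1 : ℤˣ) ≠ 1 := by decide
  simp only [wilson_eq_trace, posMerge, negMerge, holMat_append, holMat_singleton,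
    getElem_eq_of_mem_occ hx]
  rcases sgn_cases w₁ x with h1 | h1 <;> rcases sgn_cases w₂ y with h2 | h2
  · rw [holMat_root_of_pos Q hx h1, holMat_root_inv_of_pos Q hy h2, Matrix.trace_mul_comm]
    simp only [h1, h2, Word.pow, one_mul, if_neg hne, if_true]
    rw [mul_assoc, ← mul_assoc (stepMat Q (e, -1)), stepMat_neg_mul_stepMat, one_mul]
  · rw [holMat_root_of_pos Q hx h1, holMat_root_inv_of_neg Q hy h2, Matrix.trace_mul_comm]
    simp only [h1, h2, Word.pow, one_mul, if_neg hne]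
    simp only [mul_assoc]
  · rw [holMat_root_of_neg Q hx h1, holMat_root_inv_of_pos Q hy h2]
    simp only [h1, h2, Word.pow, mul_one, if_neg hne]
    rw [mul_assoc, Matrix.trace_mul_comm]
    simp only [mul_assoc]
  · rw [holMat_root_of_neg Q hx h1, holMat_root_inv_of_neg Q hy h2]
    simp only [h1, h2, Word.pow, neg_mul_neg, one_mul, if_neg hne, if_true]
    rw [mul_assoc, ← mul_assoc (stepMat Q (e, -1)), stepMat_neg_mul_stepMat, one_mul,
      Matrix.trace_mul_comm]

end Contractions

/-! The contracted Schwinger–Dyson equation -/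

section MasterLoop

variable {V E F : Type*} [Fintype F] [DecidableEq E] (K : TwoComplex V E F) {N : ℕ}
  {k : GaugeKind} (β : ℝ) {e : E}

/-- The Wilson loop of the merger of `w₁` and `w₂` whose kind agrees with the product of the
signs. -/
def mergeLoop (w₁ w₂ : Word E) (x : Fin w₁.length) (y : Fin w₂.length) (Q : GaugeField N k E) : ℂ :=
  if sgn w₁ x * sgn w₂ y = 1 then wilson (posMerge w₁ w₂ x y) Q
  else wilson (negMerge w₁ w₂ x y) Q

omit [DecidableEq E] in
@[fun_prop]
theorem continuous_mergeLoop (w₁ w₂ : Word E) (x : Fin w₁.length) (y : Fin w₂.length) :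
    Continuous (mergeLoop (N := N) (k := k) w₁ w₂ x y) := by
  unfold mergeLoop
  split_ifs <;> fun_prop

theorem gradAction_one (Q : GaugeField N k E) :
    gradAction K β e Q 1 = (β : ℂ) * N / 2 * ∑ p : F, (winding e (K.bdry p) : ℂ) *
      (wilson (K.bdry p) Q - wilson (K.bdry p).inv Q) := by
  rw [gradAction]
  congr 1
  refine Finset.sum_congr rfl fun p _ => ?_
  rw [gradHol_one, gradHol_one, winding_inv, Matrix.trace_smul, Matrix.trace_smul,
    ← wilson_eq_trace, ← wilson_eq_trace]
  push_cast
  simp only [smul_eq_mul]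
  ring

theorem contract_gradHol {w : Word E} {x : Fin w.length} (hx : x ∈ occ e w)
    (Q : GaugeField N k E) (w' : Word E) :
    ∑ a : Fin N, ∑ b : Fin N, holMat Q (root w x) a b *
        (gradHol e Q (Matrix.single a b 1) w').trace
      = ∑ y ∈ occ e w', ((sgn w' y : ℤ) : ℂ) * mergeLoop w w' x y Q := by
  simp only [trace_gradHol, Finset.mul_sum]
  rw [Finset.sum_congr rfl fun a _ => Finset.sum_comm, Finset.sum_comm]
  refine Finset.sum_congr rfl fun y hy => ?_
  simp only [mul_left_comm _ (((sgn w' y : ℤ) : ℂ)), ← Finset.mul_sum]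
  rw [sum_apply_mul_trace_single, trace_holMat_root_mul Q hx hy, mergeLoop]

theorem contract_gradHol_inv {w : Word E} {x : Fin w.length} (hx : x ∈ occ e w)
    (Q : GaugeField N k E) (w' : Word E) :
    ∑ a : Fin N, ∑ b : Fin N, holMat Q (root w x) a b *
        (gradHol e Q (Matrix.single a b 1) w'.inv).trace
      = -∑ y ∈ occ e w', ((sgn w' y : ℤ) : ℂ) *
        (if sgn w x * sgn w' y = 1 then wilson (negMerge w w' x y) Q
          else wilson (posMerge w w' x y) Q) := by
  simp only [trace_gradHol_inv, Finset.mul_sum, mul_neg, Finset.sum_neg_distrib]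
  rw [Finset.sum_congr rfl fun a _ => Finset.sum_comm, Finset.sum_comm]
  congr 1
  refine Finset.sum_congr rfl fun y hy => ?_
  simp only [mul_left_comm _ (((sgn w' y : ℤ) : ℂ)), ← Finset.mul_sum]
  rw [sum_apply_mul_trace_single, trace_holMat_root_mul_inv Q hx hy]

/-- For each `y`, one orientation of the plaquette yields the positive merger with sign `ω_x` and
the other the negative merger with sign `-ω_x`, whatever `ω_y` is. This is why the plaquette sums
carry no sign condition. -/
theorem contract_gradAction {w : Word E} {x : Fin w.length} (hx : x ∈ occ e w)
    (Q : GaugeField N k E) :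
    ∑ a : Fin N, ∑ b : Fin N, holMat Q (root w x) a b * gradAction K β e Q (Matrix.single a b 1)
      = ((sgn w x : ℤ) : ℂ) * ((β : ℂ) * N / 2 * ∑ p : F, ∑ y ∈ occ e (K.bdry p),
        (wilson (posMerge w (K.bdry p) x y) Q - wilson (negMerge w (K.bdry p) x y) Q)) := by
  have hne : (-1 : ℤˣ) ≠ 1 := by decide
  simp only [gradAction, mul_left_comm _ ((β : ℂ) * N / 2), ← Finset.mul_sum]
  congr 1
  simp only [Finset.mul_sum, mul_add]
  rw [Finset.sum_congr rfl fun a _ => Finset.sum_comm, Finset.sum_comm]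
  refine Finset.sum_congr rfl fun p _ => ?_
  simp only [Finset.sum_add_distrib]
  rw [contract_gradHol hx, contract_gradHol_inv hx, ← sub_eq_add_neg, ← Finset.sum_sub_distrib]
  refine Finset.sum_congr rfl fun y _ => ?_
  rw [mergeLoop]
  rcases sgn_cases w x with h1 | h1 <;> rcases sgn_cases (K.bdry p) y with h2 | h2 <;>
    (simp [h1, h2, hne] <;> ring)

variable [Fintype E]

/-- The Schwinger–Dyson equation of the loop `w` cut open at `x`, contracted with the inverse of
the invariant form on the Lie algebra of the structure group. -/
theorem ymExp_contracted (hN : 1 ≤ N) {ι : Type*} [Fintype ι] [DecidableEq ι] (w : Word E)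
    (ℓ : ι → Word E) {x : Fin w.length} (hx : x ∈ occ e w) :
    ymExp K N k β (fun Q =>
      (((sgn w x : ℤ) : ℂ) * N * wilson w Q
        + ∑ y ∈ (occ e w).erase x, ((sgn w y : ℤ) : ℂ) * splitProd w x y Q) * ∏ j, wilson (ℓ j) Q
      + (∑ i, ∑ y ∈ occ e (ℓ i), ((sgn (ℓ i) y : ℤ) : ℂ) *
          (mergeLoop w (ℓ i) x y Q * ∏ j ∈ Finset.univ.erase i, wilson (ℓ j) Q))
      + ((sgn w x : ℤ) : ℂ) * ((β : ℂ) * N / 2 * ∑ p : F, ∑ y ∈ occ e (K.bdry p),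
          (wilson (posMerge w (K.bdry p) x y) Q - wilson (negMerge w (K.bdry p) x y) Q))
        * ∏ j, wilson (ℓ j) Q
      - k.eta / N * (((winding e w + ∑ i, winding e (ℓ i) : ℤ) : ℂ)
            * (wilson w Q * ∏ j, wilson (ℓ j) Q)
          + (β : ℂ) * N / 2 * (∑ p : F, (winding e (K.bdry p) : ℂ) *
              (wilson (K.bdry p) Q - wilson (K.bdry p).inv Q))
            * (wilson w Q * ∏ j, wilson (ℓ j) Q))) = 0 := by
  have hN' : (N : ℂ) ≠ 0 := by exact_mod_cast (by omega : N ≠ 0)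
  let f : Fin N → Fin N → GaugeField N k E → ℂ := fun a b Q =>
    holMat Q (root w x) a b * ∏ j, wilson (ℓ j) Q
  let D : Fin N → Fin N → GaugeField N k E → Matrix (Fin N) (Fin N) ℂ → ℂ := fun a b Q X =>
    gradHol e Q X (root w x) a b * ∏ j, wilson (ℓ j) Q
      + holMat Q (root w x) a b *
        ∑ i, (gradHol e Q X (ℓ i)).trace * ∏ j ∈ Finset.univ.erase i, wilson (ℓ j) Q
  let g : Fin N → Fin N → GaugeField N k E → Matrix (Fin N) (Fin N) ℂ → ℂ := fun a b Q X =>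
    D a b Q X + f a b Q * gradAction K β e Q X
  have hgrad : ∀ a b, HasGrad e (f a b) (D a b) := fun a b =>
    (hasGradMat_holMat e (root w x) a b).mul (HasGrad.prod fun i _ => hasGrad_wilson e (ℓ i))
  have hDadd : ∀ a b Q X Y, D a b Q (X + Y) = D a b Q X + D a b Q Y := by
    intro a b Q X Y
    simp only [D, gradHol_add, Matrix.add_apply, Matrix.trace_add, add_mul, mul_add,
      Finset.sum_add_distrib]
    ring
  have hDsmul : ∀ a b Q (c : ℂ) X, D a b Q (c • X) = c * D a b Q X := by
    intro a b Q c X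
    simp only [D, gradHol_smul, Matrix.smul_apply, Matrix.trace_smul, smul_eq_mul, mul_add,
      Finset.mul_sum, mul_assoc, mul_left_comm c]
  have hgadd : ∀ a b Q X Y, g a b Q (X + Y) = g a b Q X + g a b Q Y := by
    intro a b Q X Y
    simp only [g, hDadd, gradAction_add]
    ring
  have hgsmul : ∀ a b Q (c : ℂ) X, g a b Q (c • X) = c * g a b Q X := by
    intro a b Q c X
    simp only [g, hDsmul, gradAction_smul]
    ring
  have hgcont : ∀ a b X, Continuous fun Q => g a b Q X := fun a b X =>
    ((hgrad a b).cont_grad X).add ((hgrad a b).cont.mul ((hasGrad_action K β e).cont_grad X))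
  -- For `SU` this is the traceless part of the matrix unit, and for `U`, where `eta` is 0, the
  -- matrix unit itself. The correction lives on `a = b`, so after summation it involves only traces
  -- and the scalar direction.
  let X : Fin N → Fin N → Matrix (Fin N) (Fin N) ℂ := fun a b =>
    Matrix.single a b 1 + (if a = b then -(k.eta / N) else 0) • 1
  have hX : ∀ a b, k = .SU → (X a b).trace = 0 := by
    rintro a b rfl
    simp only [X, Matrix.trace_add, Matrix.trace_smul, Matrix.trace_one, Fintype.card_fin]
    by_cases hab : a = b
    · subst hab
      simp [GaugeKind.eta, hN']
    · simp [hab]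
  have hzero : ∑ a, ∑ b, ymExp K N k β (fun Q => g a b Q (X a b)) = 0 :=
    Finset.sum_eq_zero fun a _ => Finset.sum_eq_zero fun b _ =>
      ymExp_grad K β (hgrad a b) (hDadd a b) (hDsmul a b) (hX a b)
  have hsum : ymExp K N k β (fun Q => ∑ a, ∑ b, g a b Q (X a b)) = 0 := by
    rw [ymExp_sum K β _ fun a => continuous_finsetSum _ fun b _ => hgcont a b (X a b), ← hzero]
    exact Finset.sum_congr rfl fun a _ => ymExp_sum K β _ fun b => hgcont a b (X a b)
  rw [← hsum]
  congr 1
  funext Q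
  have hsplit : ∑ a, ∑ b, g a b Q (X a b)
      = ∑ a, ∑ b, g a b Q (Matrix.single a b 1) - k.eta / N * ∑ a, g a a Q 1 := by
    simp only [X, hgadd, hgsmul, Finset.sum_add_distrib, ite_mul, zero_mul, Finset.sum_ite_eq,
      Finset.mem_univ, if_true, neg_mul, Finset.sum_neg_distrib, ← Finset.mul_sum]
    ring
  have hone : ∑ a, g a a Q 1 = ((winding e w + ∑ i, winding e (ℓ i) : ℤ) : ℂ)
            * (wilson w Q * ∏ j, wilson (ℓ j) Q)
          + gradAction K β e Q 1 * (wilson w Q * ∏ j, wilson (ℓ j) Q) := by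
    have hw : ∑ a, holMat Q (root w x) a a = wilson w Q := wilson_root Q w x
    have hprod : ∀ i, wilson (ℓ i) Q * ∏ j ∈ Finset.univ.erase i, wilson (ℓ j) Q
        = ∏ j, wilson (ℓ j) Q := fun i => Finset.mul_prod_erase _ (fun j => wilson (ℓ j) Q) (Finset.mem_univ i)
    simp only [g, D, f, gradHol_one, Matrix.smul_apply, Matrix.trace_smul, smul_eq_mul,
      ← wilson_eq_trace, mul_assoc, hprod, ← Finset.sum_mul, winding_root,
      Finset.sum_add_distrib, ← Finset.mul_sum, hw]
    push_cast
    ring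
  have hmain : ∑ a, ∑ b, g a b Q (Matrix.single a b 1)
      = (∑ a, ∑ b, gradHol e Q (Matrix.single a b 1) (root w x) a b) * ∏ j, wilson (ℓ j) Q
        + (∑ i, (∑ a, ∑ b, holMat Q (root w x) a b * (gradHol e Q (Matrix.single a b 1) (ℓ i)).trace)
            * ∏ j ∈ Finset.univ.erase i, wilson (ℓ j) Q)
        + (∑ a, ∑ b, holMat Q (root w x) a b * gradAction K β e Q (Matrix.single a b 1))
          * ∏ j, wilson (ℓ j) Q := by
    simp only [g, D, f, Finset.sum_add_distrib, Finset.sum_mul, Finset.mul_sum]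
    congr 1
    · congr 1
      rw [Finset.sum_congr rfl fun a _ => Finset.sum_comm, Finset.sum_comm]
      exact Finset.sum_congr rfl fun i _ => Finset.sum_congr rfl fun a _ =>
        Finset.sum_congr rfl fun b _ => by ring
    · exact Finset.sum_congr rfl fun a _ => Finset.sum_congr rfl fun b _ => by ring
  rw [hsplit, hone, hmain, contract_gradHol_root Q hx, contract_gradAction K β hx, gradAction_one]
  simp only [contract_gradHol hx, Finset.sum_mul, mul_assoc]

end MasterLoop

/-! ### Distributing the expectation and summing over the occurrences -/

section Assembly

variable {V E F : Type*} [Fintype F] [DecidableEq E] [Fintype E] (K : TwoComplex V E F) {N : ℕ}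
  {k : GaugeKind} (β : ℝ) {e : E}

theorem ymExp_contracted_expand (hN : 1 ≤ N) {ι : Type*} [Fintype ι] [DecidableEq ι] (w : Word E)
    (ℓ : ι → Word E) {x : Fin w.length} (hx : x ∈ occ e w) :
    ((sgn w x : ℤ) : ℂ) * N * ymExp K N k β (fun Q => wilson w Q * ∏ j, wilson (ℓ j) Q)
      + ∑ y ∈ (occ e w).erase x, ((sgn w y : ℤ) : ℂ) *
          ymExp K N k β (fun Q => splitProd w x y Q * ∏ j, wilson (ℓ j) Q)
      + ∑ i, ∑ y ∈ occ e (ℓ i), ((sgn (ℓ i) y : ℤ) : ℂ) *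
          ymExp K N k β (fun Q => mergeLoop w (ℓ i) x y Q
            * ∏ j ∈ Finset.univ.erase i, wilson (ℓ j) Q)
      + ((sgn w x : ℤ) : ℂ) * ((β : ℂ) * N / 2) * ∑ p : F, ∑ y ∈ occ e (K.bdry p),
          (ymExp K N k β (fun Q => wilson (posMerge w (K.bdry p) x y) Q * ∏ j, wilson (ℓ j) Q)
            - ymExp K N k β (fun Q => wilson (negMerge w (K.bdry p) x y) Q * ∏ j, wilson (ℓ j) Q))
      - k.eta / N * ((winding e w + ∑ i, winding e (ℓ i) : ℤ) : ℂ)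
          * ymExp K N k β (fun Q => wilson w Q * ∏ j, wilson (ℓ j) Q)
      - k.eta / N * ((β : ℂ) * N / 2) * ∑ p : F, (winding e (K.bdry p) : ℂ) *
          (ymExp K N k β (fun Q => wilson w Q * wilson (K.bdry p) Q * ∏ j, wilson (ℓ j) Q)
            - ymExp K N k β (fun Q =>
                wilson w Q * wilson (K.bdry p).inv Q * ∏ j, wilson (ℓ j) Q)) = 0 := by
  have hs : ∀ y, Continuous fun Q : GaugeField N k E =>
      splitProd w x y Q * ∏ j, wilson (ℓ j) Q := fun y =>
    (continuous_splitProd w x y).mul (by fun_prop)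
  have hm : ∀ i y, Continuous fun Q : GaugeField N k E =>
      mergeLoop w (ℓ i) x y Q * ∏ j ∈ Finset.univ.erase i, wilson (ℓ j) Q := fun i y =>
    (continuous_mergeLoop w (ℓ i) x y).mul (by fun_prop)
  have hw : ∀ w' : Word E, Continuous fun Q : GaugeField N k E =>
      wilson w' Q * ∏ j, wilson (ℓ j) Q := fun w' => by fun_prop
  have hww : ∀ w' : Word E, Continuous fun Q : GaugeField N k E =>
      wilson w Q * wilson w' Q * ∏ j, wilson (ℓ j) Q := fun w' => by fun_prop
  rw [← ymExp_contracted (k := k) K β hN w ℓ hx]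
  simp only [← ymExp_const_mul, ← ymExp_sub K β (hw _) (hw _), ← ymExp_sub K β (hww _) (hww _)]
  have hs' := fun y => (hs y).const_mul ((sgn w y : ℤ) : ℂ)
  have hm' := fun i y => (hm i y).const_mul ((sgn (ℓ i) y : ℤ) : ℂ)
  have hp := fun p y => (hw (posMerge w (K.bdry p) x y)).fun_sub (hw (negMerge w (K.bdry p) x y))
  have hq := fun p => ((hww (K.bdry p)).fun_sub (hww (K.bdry p).inv)).const_mul
    (winding e (K.bdry p) : ℂ)
  have hm'' := fun i => continuous_finsetSum (occ e (ℓ i)) fun y _ => hm' i y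
  have hp' := fun p => continuous_finsetSum (occ e (K.bdry p)) fun y _ => hp p y
  simp only [← ymExp_sum K β _ hs', ← ymExp_sum K β _ (hm' _), ← ymExp_sum K β _ hm'',
    ← ymExp_sum K β _ (hp _), ← ymExp_sum K β _ hp', ← ymExp_sum K β _ hq, ← ymExp_const_mul]
  have c1 := (hw w).const_mul (((sgn w x : ℤ) : ℂ) * N)
  have c2 := continuous_finsetSum ((occ e w).erase x) fun y _ => hs' y
  have c3 := continuous_finsetSum Finset.univ fun i _ => hm'' i
  have c4 := (continuous_finsetSum Finset.univ fun p _ => hp' p).const_mul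
    (((sgn w x : ℤ) : ℂ) * ((β : ℂ) * N / 2))
  have c5 := (hw w).const_mul (k.eta / N * ((winding e w + ∑ i, winding e (ℓ i) : ℤ) : ℂ))
  have c6 := (continuous_finsetSum Finset.univ fun p _ => hq p).const_mul
    (k.eta / N * ((β : ℂ) * N / 2))
  rw [← ymExp_add K β c1 c2, ← ymExp_add K β (c1.fun_add c2) c3,
    ← ymExp_add K β ((c1.fun_add c2).fun_add c3) c4, ← ymExp_sub K β (((c1.fun_add c2).fun_add c3).fun_add c4) c5,
    ← ymExp_sub K β ((((c1.fun_add c2).fun_add c3).fun_add c4).fun_sub c5) c6]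
  congr 1
  funext Q
  have e1 : ∑ y ∈ (occ e w).erase x, ((sgn w y : ℤ) : ℂ) *
      (splitProd w x y Q * ∏ j, wilson (ℓ j) Q) = (∑ y ∈ (occ e w).erase x,
        ((sgn w y : ℤ) : ℂ) * splitProd w x y Q) * ∏ j, wilson (ℓ j) Q := by
    simp only [Finset.sum_mul, mul_assoc]
  have e2 : ∑ p : F, ∑ y ∈ occ e (K.bdry p),
      (wilson (posMerge w (K.bdry p) x y) Q * ∏ j, wilson (ℓ j) Q
        - wilson (negMerge w (K.bdry p) x y) Q * ∏ j, wilson (ℓ j) Q)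
      = (∑ p : F, ∑ y ∈ occ e (K.bdry p), (wilson (posMerge w (K.bdry p) x y) Q
        - wilson (negMerge w (K.bdry p) x y) Q)) * ∏ j, wilson (ℓ j) Q := by
    simp only [Finset.sum_mul, sub_mul]
  have e3 : ∑ p : F, (winding e (K.bdry p) : ℂ) *
      (wilson w Q * wilson (K.bdry p) Q * ∏ j, wilson (ℓ j) Q
        - wilson w Q * wilson (K.bdry p).inv Q * ∏ j, wilson (ℓ j) Q)
      = (∑ p : F, (winding e (K.bdry p) : ℂ) * (wilson (K.bdry p) Q - wilson (K.bdry p).inv Q))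
        * (wilson w Q * ∏ j, wilson (ℓ j) Q) := by
    rw [Finset.sum_mul]
    exact Finset.sum_congr rfl fun p _ => by ring
  rw [e1, e2, e3]
  ring

/-- The product of signs is 1 on the first branch and -1 on the second, which turns a signed sum
into a difference of sums over pairs with equal and with opposite orientation. -/
theorem sum_sign_mul_ite {ι : Type*} (s : Finset ι) (σ : ℤˣ) (τ : ι → ℤˣ) (a b : ι → ℂ) :
    ((σ : ℤ) : ℂ) * ∑ y ∈ s, ((τ y : ℤ) : ℂ) * (if σ * τ y = 1 then a y else b y)
      = ∑ y ∈ s with σ * τ y = 1, a y - ∑ y ∈ s with σ * τ y = -1, b y := by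
  have hne : (-1 : ℤˣ) ≠ 1 := by decide
  rw [Finset.sum_filter, Finset.sum_filter, ← Finset.sum_sub_distrib, Finset.mul_sum]
  refine Finset.sum_congr rfl fun y _ => ?_
  rcases Int.units_eq_one_or σ with h | h <;> rcases Int.units_eq_one_or (τ y) with h' | h' <;>
    simp [h, h', hne, hne.symm]

end Assembly

end LatticeYM

theorem theorem2 {V E F : Type*} [Fintype V] [Fintype E] [DecidableEq E] [Fintype F]
    (K : TwoComplex V E F) (N : ℕ) (hN : 1 ≤ N) (k : GaugeKind) (β : ℝ)
    (n : ℕ) (ℓ : Fin (n + 1) → Word E) (hℓ : ∀ i, K.IsLoop (ℓ i))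
    (e : E) (he : ∃ i, (occ e (ℓ i)).Nonempty) :
    (((occ e (ℓ 0)).card : ℂ) * N
        - k.eta * (winding e (ℓ 0) : ℂ) * ((∑ i, winding e (ℓ i) : ℤ) : ℂ) / N)
      * ymExp K N k β (fun Q => ∏ i, wilson (ℓ i) Q)
    = (∑ x ∈ occ e (ℓ 0), ∑ y ∈ occ e (ℓ 0) with sgn (ℓ 0) x * sgn (ℓ 0) y = -1,
        ymExp K N k β (fun Q => wilson (negSplit (ℓ 0) x y) Q * wilson (negSplit (ℓ 0) y x) Q
          * ∏ j : Fin n, wilson (ℓ j.succ) Q))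
      - (∑ x ∈ occ e (ℓ 0), ∑ y ∈ occ e (ℓ 0) with x ≠ y ∧ sgn (ℓ 0) x * sgn (ℓ 0) y = 1,
        ymExp K N k β (fun Q => wilson (posSplit (ℓ 0) x y) Q * wilson (posSplit (ℓ 0) y x) Q
          * ∏ j : Fin n, wilson (ℓ j.succ) Q))
      + (∑ i : Fin n, ∑ x ∈ occ e (ℓ 0),
          ∑ y ∈ occ e (ℓ i.succ) with sgn (ℓ 0) x * sgn (ℓ i.succ) y = -1,
        ymExp K N k β (fun Q => wilson (negMerge (ℓ 0) (ℓ i.succ) x y) Q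
          * ∏ j ∈ Finset.univ.erase i, wilson (ℓ j.succ) Q))
      - (∑ i : Fin n, ∑ x ∈ occ e (ℓ 0),
          ∑ y ∈ occ e (ℓ i.succ) with sgn (ℓ 0) x * sgn (ℓ i.succ) y = 1,
        ymExp K N k β (fun Q => wilson (posMerge (ℓ 0) (ℓ i.succ) x y) Q
          * ∏ j ∈ Finset.univ.erase i, wilson (ℓ j.succ) Q))
      + (β : ℂ) * N / 2 * (∑ p ∈ posPlaq K e, ∑ x ∈ occ e (ℓ 0), ∑ y ∈ occ e (K.bdry p),
        ymExp K N k β (fun Q => wilson (negMerge (ℓ 0) (K.bdry p) x y) Q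
          * ∏ j : Fin n, wilson (ℓ j.succ) Q))
      - (β : ℂ) * N / 2 * (∑ p ∈ posPlaq K e, ∑ x ∈ occ e (ℓ 0), ∑ y ∈ occ e (K.bdry p),
        ymExp K N k β (fun Q => wilson (posMerge (ℓ 0) (K.bdry p) x y) Q
          * ∏ j : Fin n, wilson (ℓ j.succ) Q))
      - k.eta * (β : ℂ) / 2 * (∑ p ∈ plaq K e,
        (winding e (ℓ 0) : ℂ) * (winding e (K.obdry p) : ℂ)
          * ymExp K N k β (fun Q => wilson (ℓ 0) Q * wilson (K.obdry p).inv Q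
            * ∏ j : Fin n, wilson (ℓ j.succ) Q)) := by
  have hN' : (N : ℂ) ≠ 0 := by exact_mod_cast (by omega : N ≠ 0)
  have hne : (-1 : ℤˣ) ≠ 1 := by decide
  set w := ℓ 0 with hw
  have hW0 : ymExp K N k β (fun Q => ∏ i, wilson (ℓ i) Q)
      = ymExp K N k β (fun Q => wilson w Q * ∏ j : Fin n, wilson (ℓ j.succ) Q) := by
    simp only [Fin.prod_univ_succ, hw]
  have hwind : ∑ i, winding e (ℓ i) = winding e w + ∑ i : Fin n, winding e (ℓ i.succ) :=
    Fin.sum_univ_succ _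
  rw [hW0, hwind]
  -- the sums over plaquettes
  have hposPlaq : ∀ f : (p : F) → Fin w.length → Fin (K.bdry p).length → ℂ,
      ∑ p ∈ posPlaq K e, ∑ x ∈ occ e w, ∑ y ∈ occ e (K.bdry p), f p x y
        = ∑ x ∈ occ e w, ∑ p : F, ∑ y ∈ occ e (K.bdry p), f p x y := by
    intro f
    rw [Finset.sum_comm]
    refine Finset.sum_congr rfl fun x _ => Finset.sum_subset (Finset.subset_univ _) ?_
    intro p _ hp
    have : occ e (K.bdry p) = ∅ := by simpa [posPlaq] using hp
    rw [this, Finset.sum_empty]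
  -- Reversing a plaquette negates its winding, so its two orientations together give `t_p (W_{p⁻¹}
  -- - W_p)`. Plaquettes that avoid `e` have winding 0, so the sum may run over all of them.
  have hplaq : ∑ p ∈ plaq K e, (winding e w : ℂ) * (winding e (K.obdry p) : ℂ)
          * ymExp K N k β (fun Q => wilson w Q * wilson (K.obdry p).inv Q
            * ∏ j : Fin n, wilson (ℓ j.succ) Q)
      = (winding e w : ℂ) * -∑ p : F, (winding e (K.bdry p) : ℂ) *
          (ymExp K N k β (fun Q => wilson w Q * wilson (K.bdry p) Q
              * ∏ j : Fin n, wilson (ℓ j.succ) Q)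
            - ymExp K N k β (fun Q =>
                wilson w Q * wilson (K.bdry p).inv Q * ∏ j : Fin n, wilson (ℓ j.succ) Q)) := by
    rw [Finset.sum_subset (Finset.subset_univ (plaq K e)), Fintype.sum_prod_type,
      ← Finset.sum_neg_distrib, Finset.mul_sum]
    · refine Finset.sum_congr rfl fun p _ => ?_
      have huniv : (Finset.univ : Finset ℤˣ) = {1, -1} := by decide
      rw [huniv, Finset.sum_pair hne.symm]
      simp only [TwoComplex.obdry, Word.pow, if_true, if_neg hne, winding_inv, Word.inv_inv]
      push_cast
      ring
    · intro p _ hp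
      have : ¬(occ e (K.obdry p)).Nonempty := by simpa [plaq] using hp
      rw [winding_eq_zero_of_occ_eq_empty e this]
      simp
  rw [hplaq, hposPlaq, hposPlaq, Finset.sum_comm (s := Finset.univ),
    Finset.sum_comm (s := Finset.univ)]
  -- the equation at a position `x`, multiplied by its sign
  have hx : ∀ x ∈ occ e w, (N : ℂ) * ymExp K N k β (fun Q => wilson w Q
          * ∏ j : Fin n, wilson (ℓ j.succ) Q)
      + ((∑ y ∈ occ e w with x ≠ y ∧ sgn w x * sgn w y = 1,
          ymExp K N k β (fun Q => wilson (posSplit w x y) Q * wilson (posSplit w y x) Q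
            * ∏ j : Fin n, wilson (ℓ j.succ) Q))
        - ∑ y ∈ occ e w with sgn w x * sgn w y = -1,
          ymExp K N k β (fun Q => wilson (negSplit w x y) Q * wilson (negSplit w y x) Q
            * ∏ j : Fin n, wilson (ℓ j.succ) Q))
      + ((∑ i : Fin n, ∑ y ∈ occ e (ℓ i.succ) with sgn w x * sgn (ℓ i.succ) y = 1,
          ymExp K N k β (fun Q => wilson (posMerge w (ℓ i.succ) x y) Q
            * ∏ j ∈ Finset.univ.erase i, wilson (ℓ j.succ) Q))
        - ∑ i : Fin n, ∑ y ∈ occ e (ℓ i.succ) with sgn w x * sgn (ℓ i.succ) y = -1,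
          ymExp K N k β (fun Q => wilson (negMerge w (ℓ i.succ) x y) Q
            * ∏ j ∈ Finset.univ.erase i, wilson (ℓ j.succ) Q))
      + (β : ℂ) * N / 2 * ((∑ p : F, ∑ y ∈ occ e (K.bdry p),
          ymExp K N k β (fun Q => wilson (posMerge w (K.bdry p) x y) Q
            * ∏ j : Fin n, wilson (ℓ j.succ) Q))
        - ∑ p : F, ∑ y ∈ occ e (K.bdry p),
          ymExp K N k β (fun Q => wilson (negMerge w (K.bdry p) x y) Q
            * ∏ j : Fin n, wilson (ℓ j.succ) Q))
      = ((sgn w x : ℤ) : ℂ) * (k.eta / N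
          * ((winding e w + ∑ i : Fin n, winding e (ℓ i.succ) : ℤ) : ℂ)
          * ymExp K N k β (fun Q => wilson w Q * ∏ j : Fin n, wilson (ℓ j.succ) Q)
        + k.eta * β / 2 * ∑ p : F, (winding e (K.bdry p) : ℂ) *
          (ymExp K N k β (fun Q => wilson w Q * wilson (K.bdry p) Q
              * ∏ j : Fin n, wilson (ℓ j.succ) Q)
            - ymExp K N k β (fun Q =>
                wilson w Q * wilson (K.bdry p).inv Q
                  * ∏ j : Fin n, wilson (ℓ j.succ) Q))) := by
    intro x hx
    have h := ymExp_contracted_expand (k := k) K β hN w (fun j : Fin n => ℓ j.succ) hx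
    -- `ω_x² = 1` removes the sign from the constant term and from the plaquette term when the
    -- identity is multiplied by `ω_x`.
    have hsq : ((sgn w x : ℤ) : ℂ) * ((sgn w x : ℤ) : ℂ) = 1 := by
      rcases sgn_cases w x with h | h <;> simp [h]
    have hsplit : ((sgn w x : ℤ) : ℂ) * ∑ y ∈ (occ e w).erase x, ((sgn w y : ℤ) : ℂ) *
          ymExp K N k β (fun Q => splitProd w x y Q * ∏ j : Fin n, wilson (ℓ j.succ) Q)
        = (∑ y ∈ occ e w with x ≠ y ∧ sgn w x * sgn w y = 1,
          ymExp K N k β (fun Q => wilson (posSplit w x y) Q * wilson (posSplit w y x) Q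
            * ∏ j : Fin n, wilson (ℓ j.succ) Q))
        - ∑ y ∈ occ e w with sgn w x * sgn w y = -1,
          ymExp K N k β (fun Q => wilson (negSplit w x y) Q * wilson (negSplit w y x) Q
            * ∏ j : Fin n, wilson (ℓ j.succ) Q) := by
      have hite : ∀ y, ymExp K N k β (fun Q => splitProd w x y Q
            * ∏ j : Fin n, wilson (ℓ j.succ) Q)
          = if sgn w x * sgn w y = 1 then
              ymExp K N k β (fun Q => wilson (posSplit w x y) Q * wilson (posSplit w y x) Q
                * ∏ j : Fin n, wilson (ℓ j.succ) Q)
            else ymExp K N k β (fun Q => wilson (negSplit w x y) Q * wilson (negSplit w y x) Q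
                * ∏ j : Fin n, wilson (ℓ j.succ) Q) := by
        intro y
        unfold splitProd
        split_ifs <;> rfl
      simp only [hite]
      rw [sum_sign_mul_ite]
      congr 1
      · refine Finset.sum_congr ?_ fun _ _ => rfl
        ext y
        simp only [Finset.mem_filter, Finset.mem_erase, ne_comm (a := y)]
        tauto
      · refine Finset.sum_congr ?_ fun _ _ => rfl
        ext y
        simp only [Finset.mem_filter, Finset.mem_erase]
        constructor
        · tauto
        -- The case `y = x` is excluded automatically, since `ω_x ω_x = 1`.
        · rintro ⟨hy, hs⟩
          refine ⟨⟨?_, hy⟩, hs⟩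
          rintro rfl
          rw [Int.units_mul_self] at hs
          exact hne hs.symm
    have hmerge : ((sgn w x : ℤ) : ℂ) * ∑ i : Fin n, ∑ y ∈ occ e (ℓ i.succ),
          ((sgn (ℓ i.succ) y : ℤ) : ℂ) * ymExp K N k β (fun Q => mergeLoop w (ℓ i.succ) x y Q
            * ∏ j ∈ Finset.univ.erase i, wilson (ℓ j.succ) Q)
        = (∑ i : Fin n, ∑ y ∈ occ e (ℓ i.succ) with sgn w x * sgn (ℓ i.succ) y = 1,
          ymExp K N k β (fun Q => wilson (posMerge w (ℓ i.succ) x y) Q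
            * ∏ j ∈ Finset.univ.erase i, wilson (ℓ j.succ) Q))
        - ∑ i : Fin n, ∑ y ∈ occ e (ℓ i.succ) with sgn w x * sgn (ℓ i.succ) y = -1,
          ymExp K N k β (fun Q => wilson (negMerge w (ℓ i.succ) x y) Q
            * ∏ j ∈ Finset.univ.erase i, wilson (ℓ j.succ) Q) := by
      rw [← Finset.sum_sub_distrib, Finset.mul_sum]
      refine Finset.sum_congr rfl fun i _ => ?_
      rw [← sum_sign_mul_ite]
      congr 1
      refine Finset.sum_congr rfl fun y _ => ?_
      unfold mergeLoop
      split_ifs <;> rfl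
    simp only [Finset.sum_sub_distrib] at h
    rw [← hsplit, ← hmerge]
    have hNN : k.eta / N * ((β : ℂ) * N / 2) = k.eta * β / 2 := by field_simp
    rw [hNN] at h
    linear_combination ((sgn w x : ℤ) : ℂ) * h
      - (N * ymExp K N k β (fun Q => wilson w Q * ∏ j : Fin n, wilson (ℓ j.succ) Q)
        + (β : ℂ) * N / 2 * ((∑ p : F, ∑ y ∈ occ e (K.bdry p),
          ymExp K N k β (fun Q => wilson (posMerge w (K.bdry p) x y) Q
            * ∏ j : Fin n, wilson (ℓ j.succ) Q))
        - ∑ p : F, ∑ y ∈ occ e (K.bdry p),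
          ymExp K N k β (fun Q => wilson (negMerge w (K.bdry p) x y) Q
            * ∏ j : Fin n, wilson (ℓ j.succ) Q))) * hsq
  have key := Finset.sum_congr rfl hx
  -- Summed over `x`, the signs left in front of the `η` terms add up to `t₁`.
  have hcast : (winding e w : ℂ) = ∑ x ∈ occ e w, ((sgn w x : ℤ) : ℂ) := by
    rw [winding_eq_sum]
    push_cast
    rfl
  simp only [Finset.sum_add_distrib, Finset.sum_sub_distrib, ← Finset.mul_sum, ← Finset.sum_mul,
    Finset.sum_const, nsmul_eq_mul, ← hcast] at key
  linear_combination key
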